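/- Let $G$ be a Hausdorff topological group with topology $\tau$, and let $\tau_\delta$ be the topology on $G$ whose base is formed by all $\mathcal{G}_\delta$-subsets of $(G,\tau)$. Suppose that $G$ is $\mathcal{G}_\delta$-complete, that is, that the topological group $(G,\tau_\delta)$ is Raikov-complete (complete with respect to its two-sided uniformity), and suppose that the topological weight of $(G,\tau)$ (the least cardinality of a base) does not exceed a cardinal $\beta \ge \aleph_0$. Then there are an infinite-dimensional real normed vector space $E$ of topological weight equal to $\beta$, a contractible open set $U \subset E$ and a nonzero vector $e \in E$ such that the topological groups $G$, $\mathrm{Iso}(U,d)$ and $\mathrm{Iso}(E|e)$ are (topologically) isomorphic. Here $d$ is the metric on $U$ induced by the norm of $E$, $\mathrm{Iso}(U,d)$ is the group of all isometries of $(U,d)$ onto itself, $\mathrm{Iso}(E|e)$ is the group of all linear isometries of $E$ onto itself which leave $e$ fixed, and both groups carry the topology of pointwise convergence. -/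

import Mathlib

open Filter Topology Cardinal

universe u

/-- The topological weight of a space: the least cardinality of a base of its topology. -/
noncomputable def topWeight (X : Type u) [TopologicalSpace X] : Cardinal.{u} :=
  sInf {c | ∃ B : Set (Set X), TopologicalSpace.IsTopologicalBasis B ∧ #B = c}

/-- The topology `τ_δ` associated with a topology `τ`: it is generated by the `G_δ`-sets of `τ`
(these are closed under finite intersections, so they form a base of `τ_δ`). -/
@[reducible]
def gDeltaTopology (X : Type u) [TopologicalSpace X] : TopologicalSpace X :=
  TopologicalSpace.generateFrom {s : Set X | IsGδ s}

/-- Raikov-completeness (completeness for the upper, i.e. two-sided, uniformity), in terms of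
filters: every proper filter for which both `x * y⁻¹` and `x⁻¹ * y` tend to the neutral element
as `x` and `y` run along the filter independently, converges. -/
def IsRaikovComplete (G : Type u) [Group G] [TopologicalSpace G] : Prop :=
  ∀ F : Filter G, F.NeBot →
    Tendsto (fun p : G × G => p.1 * p.2⁻¹) (F ×ˢ F) (𝓝 1) →
    Tendsto (fun p : G × G => p.1⁻¹ * p.2) (F ×ˢ F) (𝓝 1) →
    ∃ x : G, F ≤ 𝓝 x

/-- A topological group `(G, τ)` is `G_δ`-complete if `(G, τ_δ)` is Raikov-complete. -/
def IsGDeltaComplete (G : Type u) [Group G] [TopologicalSpace G] : Prop :=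
  @IsRaikovComplete G _ (gDeltaTopology G)

/-- The isometry group `X ≃ᵢ X` carries the topology of pointwise convergence. -/
instance isometryEquivPointwiseTopology (X : Type u) [PseudoEMetricSpace X] :
    TopologicalSpace (X ≃ᵢ X) :=
  TopologicalSpace.induced (fun f : X ≃ᵢ X => (f : X → X)) Pi.topologicalSpace

/-- The group `E ≃ₗᵢ[ℝ] E` of linear isometries of a real normed space onto itself carries the
topology of pointwise convergence. -/
instance linearIsometryEquivPointwiseTopology (E : Type u) [NormedAddCommGroup E]
    [NormedSpace ℝ E] : TopologicalSpace (E ≃ₗᵢ[ℝ] E) :=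
  TopologicalSpace.induced (fun f : E ≃ₗᵢ[ℝ] E => (f : E → E)) Pi.topologicalSpace

/-- The group of linear isometries of `E` onto itself which leave the point `e` fixed
(with the subspace topology, i.e. again with pointwise convergence). -/
def linearIsometriesFixing (E : Type u) [NormedAddCommGroup E] [NormedSpace ℝ E] (e : E) :
    Subgroup (E ≃ₗᵢ[ℝ] E) where
  carrier := {T | T e = e}
  one_mem' := rfl
  mul_mem' {S T} hS hT := by
    change S (T e) = e
    rw [show T e = e from hT]
    exact hS
  inv_mem' {T} hT := by
    change T.symm e = e
    rw [LinearIsometryEquiv.symm_apply_eq]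
    exact (show T e = e from hT).symm

/-! The group is passed through three objects, each of which has it as its full symmetry group.

A metric model with isometry group `G`. The topology comes from at most `β` left-invariant
pseudometrics bounded by one. Let `X` be the disjoint union of copies of `G`, one per pseudometric,
and take all pairs `(g, y)` with `g ∈ G` and `y` a sequence in `X`, with a distance recording both
`g y` and `y`; `G` acts on the first entry. Extra points record distances from terms of `y` to a
dense set. They are indexed by a well-ordered set whose order is also encoded metrically, and a
well-order has no nontrivial automorphism, so isometries fix the extra points and can only change
`g` in `(g, y)`. Comparing sequences that share a term yields a single map of `X` which on every
countable set agrees with translation by some element of `G`. Neighbourhoods of `1` in `τ_δ` contain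
common zero sets of countably many pseudometrics, so the agreeing elements form a Cauchy filter of
`(G, τ_δ)`. Its limit is the translation sought (`exists_translation`,
`translateContinuousMulEquiv`).

A normed space with a marked vector. For a metric space `M` of diameter at most one, the norm on the
space with basis `M ∪ {e}` is the largest seminorm with `‖m‖ ≤ 1`, `‖m - e‖ ≤ 2`, `‖e‖ ≤ 3` and `‖m
- m'‖ ≤ dist m m'`. Norm inequalities involving only `v` and `e` force `v` into the convex hull of
`M` (`mem_simplex`). A linear isometry fixing `e` and its inverse thus send `M` into this simplex,
hence permute its vertices, which form an isometric copy of `M` (`mapIsoContinuousMulEquiv`).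

An open set. Removing the ray `{t e | t ≥ 1}` leaves a dense open set, star-shaped about `0`. By the
Mazur–Ulam theorem its isometries extend to affine isometries of `E`; these preserve the ray, hence
fix it pointwise, hence are linear and fix `e` (`rayComplHom_surjective`). -/

/-! ### Continuous left-invariant pseudometrics on a topological group -/

/-- A left-invariant pseudometric bounded by one on a topological group, continuous at `1`. -/
structure LeftPseudometric (G : Type u) [Group G] [TopologicalSpace G] where
  toFun : G → G → ℝ
  self' : ∀ x, toFun x x = 0
  symm' : ∀ x y, toFun x y = toFun y x
  triangle' : ∀ x y z, toFun x z ≤ toFun x y + toFun y z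
  nonneg' : ∀ x y, 0 ≤ toFun x y
  le_one' : ∀ x y, toFun x y ≤ 1
  mul_left' : ∀ k x y, toFun (k * x) (k * y) = toFun x y
  eventually_lt' : ∀ ε > 0, ∀ᶠ g in 𝓝 (1 : G), toFun 1 g < ε

theorem exists_nhds_one_symm_cube {G : Type u} [Group G] [TopologicalSpace G]
    [IsTopologicalGroup G] (V : Set G) (hV : V ∈ 𝓝 (1 : G)) :
    ∃ W ∈ 𝓝 (1 : G), (∀ x ∈ W, x⁻¹ ∈ W) ∧ ∀ x ∈ W, ∀ y ∈ W, ∀ z ∈ W, x * y * z ∈ V := by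
  have h : Tendsto (fun p : G × G × G => p.1 * p.2.1 * p.2.2) (𝓝 (1, 1, 1)) (𝓝 1) := by
    have : Continuous (fun p : G × G × G => p.1 * p.2.1 * p.2.2) := by fun_prop
    simpa using this.tendsto (1, 1, 1)
  have h2 := h hV
  rw [Filter.mem_map, nhds_prod_eq, nhds_prod_eq, mem_prod_iff] at h2
  obtain ⟨A, hA, B, hB, hAB⟩ := h2
  rw [mem_prod_iff] at hB
  obtain ⟨B1, hB1, B2, hB2, hBB⟩ := hB
  have hC : A ∩ B1 ∩ B2 ∈ 𝓝 (1 : G) := inter_mem (inter_mem hA hB1) hB2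
  refine ⟨(A ∩ B1 ∩ B2) ∩ (A ∩ B1 ∩ B2)⁻¹, inter_mem hC (inv_mem_nhds_one G hC), ?_, ?_⟩
  · rintro x ⟨h1, h2⟩
    exact ⟨h2, by simpa using h1⟩
  · rintro x ⟨⟨⟨hx, -⟩, -⟩, -⟩ y ⟨⟨⟨-, hy⟩, -⟩, -⟩ z ⟨⟨-, hz⟩, -⟩
    exact hAB (show (x, y, z) ∈ A ×ˢ B from ⟨hx, hBB ⟨hy, hz⟩⟩)

/-- Every neighbourhood of `1` contains a ball of a continuous left-invariant pseudometric. -/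
theorem LeftPseudometric.exists_ball_subset {G : Type u} [Group G] [TopologicalSpace G]
    [IsTopologicalGroup G] (V : Set G) (hV : V ∈ 𝓝 (1 : G)) :
    ∃ ρ : LeftPseudometric G, ∃ ε > 0, ∀ g, ρ.toFun 1 g < ε → g ∈ V := by
  classical
  choose! next hn1 hn2 hn3 using exists_nhds_one_symm_cube (G := G)
  let U : ℕ → Set G := fun n => next^[n + 1] V
  have hUs : ∀ n, U (n + 1) = next (U n) := fun n => Function.iterate_succ_apply' next (n + 1) V
  have hU0 : U 0 = next V := rfl
  have hU : ∀ n, U n ∈ 𝓝 (1 : G) := by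
    intro n
    induction n with
    | zero => exact hn1 V hV
    | succ n ih => rw [hUs]; exact hn1 _ ih
  have hUsymm : ∀ n, ∀ x ∈ U n, x⁻¹ ∈ U n := by
    intro n
    cases n with
    | zero => exact hn2 V hV
    | succ n => rw [hUs]; exact hn2 _ (hU n)
  have hU3 : ∀ n, ∀ x ∈ U (n + 1), ∀ y ∈ U (n + 1), ∀ z ∈ U (n + 1), x * y * z ∈ U n := by
    intro n
    rw [hUs]; exact hn3 _ (hU n)
  have hone : ∀ n, (1 : G) ∈ U n := fun n => mem_of_mem_nhds (hU n)
  have hanti : Antitone U := antitone_nat_of_succ_le fun n x hx => by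
    simpa using hU3 n x hx 1 (hone _) 1 (hone _)
  let d : G → G → NNReal := fun x y =>
    if h : ∃ n, x⁻¹ * y ∉ U n then (1 / 2) ^ Nat.find h else 0
  have hr : (1 / 2 : NNReal) ∈ Set.Ioo (0 : NNReal) 1 :=
    ⟨half_pos one_pos, NNReal.half_lt_self one_ne_zero⟩
  have hle_d : ∀ {x y : G} {n : ℕ}, (1 / 2) ^ n ≤ d x y ↔ x⁻¹ * y ∉ U n := by
    intro x y n
    dsimp only [d]
    split_ifs with h
    · rw [(pow_right_strictAnti₀ hr.1 hr.2).le_iff_ge, Nat.find_le_iff]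
      exact ⟨fun ⟨m, hmn, hm⟩ hn => hm (hanti hmn hn), fun h => ⟨n, le_rfl, h⟩⟩
    · push Not at h
      simp only [h, not_true, iff_false, not_le]
      exact pow_pos hr.1 _
  have hd0 : ∀ x, d x x = 0 := by
    intro x
    simp [d, hone]
  have hdc : ∀ x y, d x y = d y x := by
    intro x y
    have : ∀ n, (x⁻¹ * y ∉ U n) ↔ (y⁻¹ * x ∉ U n) := by
      intro n
      refine not_congr ⟨fun h => ?_, fun h => ?_⟩
      · simpa using hUsymm n _ h
      · simpa using hUsymm n _ h
    simp only [d, this]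
  have hd1 : ∀ x y, d x y ≤ 1 := by
    intro x y
    dsimp only [d]
    split_ifs
    · exact pow_le_one₀ hr.1.le hr.2.le
    · exact zero_le_one
  have hdl : ∀ k x y, d (k * x) (k * y) = d x y := by
    intro k x y
    simp only [d, mul_inv_rev, mul_assoc, inv_mul_cancel_left]
  have hd4 : ∀ x₁ x₂ x₃ x₄, d x₁ x₄ ≤ 2 * max (d x₁ x₂) (max (d x₂ x₃) (d x₃ x₄)) := by
    intro x₁ x₂ x₃ x₄
    by_cases H : ∃ n, x₁⁻¹ * x₄ ∉ U n
    · have hval : d x₁ x₄ = (1 / 2) ^ Nat.find H := dif_pos H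
      rw [hval, ← div_le_iff₀' two_pos, ← mul_one_div (_ ^ _), ← pow_succ]
      simp only [le_max_iff, hle_d, ← not_and_or]
      rintro ⟨h₁₂, h₂₃, h₃₄⟩
      refine Nat.find_spec H ?_
      have := hU3 _ _ h₁₂ _ h₂₃ _ h₃₄
      simpa [mul_assoc] using this
    · have hval : d x₁ x₄ = 0 := dif_neg H
      rw [hval]; exact zero_le
  -- The infimum over chains turns `d` into a pseudometric `D` with `D ≤ d ≤ 2 D`; `hd4` is what the
  -- second inequality needs.
  let I := PseudoMetricSpace.ofPreNNDist d hd0 hdc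
  have hle : ∀ x y : G, @dist G I.toDist x y ≤ d x y :=
    PseudoMetricSpace.dist_ofPreNNDist_le d hd0 hdc
  have hge : ∀ x y : G, (d x y : ℝ) ≤ 2 * @dist G I.toDist x y :=
    PseudoMetricSpace.le_two_mul_dist_ofPreNNDist d hd0 hdc hd4
  let D : G → G → ℝ := fun x y => @dist G I.toDist x y
  have hDle : ∀ k x y, D (k * x) (k * y) ≤ d x y := fun k x y => by
    rw [← hdl k]; exact hle _ _
  -- The supremum over left translates forces left invariance; since `d` is invariant, `ρ` still
  -- lies between `D` and `d`.
  let ρ : G → G → ℝ := fun x y => ⨆ k : G, D (k * x) (k * y)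
  have hbdd : ∀ x y, BddAbove (Set.range fun k : G => D (k * x) (k * y)) := fun x y =>
    ⟨d x y, by rintro _ ⟨k, rfl⟩; exact hDle k x y⟩
  have hρle : ∀ x y, ρ x y ≤ d x y := fun x y => ciSup_le fun k => hDle k x y
  have hDρ : ∀ x y, D x y ≤ ρ x y := fun x y => by
    simpa using le_ciSup (hbdd x y) 1
  have hDρk : ∀ k x y, D (k * x) (k * y) ≤ ρ x y := fun k x y => le_ciSup (hbdd x y) k
  refine ⟨⟨ρ, ?_, ?_, ?_, ?_, ?_, ?_, ?_⟩, 1 / 2, by norm_num, ?_⟩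
  · intro x
    simp [ρ, D]
  · intro x y
    simp only [ρ, D]
    congr 1; ext k; exact @dist_comm G I _ _
  · intro x y z
    refine ciSup_le fun k => ?_
    exact (@dist_triangle G I _ (k * y) _).trans (add_le_add (hDρk k x y) (hDρk k y z))
  · intro x y
    exact (@dist_nonneg G I x y).trans (hDρ x y)
  · intro x y
    exact (hρle x y).trans (by exact_mod_cast hd1 x y)
  · intro k x y
    refine le_antisymm (ciSup_le fun l => ?_) (ciSup_le fun l => ?_)
    · simpa [mul_assoc] using hDρk (l * k) x y
    · simpa [mul_assoc] using hDρk (l * k⁻¹) (k * x) (k * y)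
  · intro ε hε
    obtain ⟨n, hn⟩ := exists_pow_lt_of_lt_one hε (by norm_num : (1 / 2 : ℝ) < 1)
    filter_upwards [hU n] with g hg
    refine (hρle 1 g).trans_lt (lt_of_le_of_lt ?_ hn)
    have : ¬ ((1 / 2) ^ n ≤ d 1 g) := by rw [hle_d]; simpa using hg
    exact_mod_cast (not_le.1 this).le
  · intro g hg
    change ρ 1 g < 1 / 2 at hg
    have h1 : (d 1 g : ℝ) < 1 := by
      have := hge 1 g
      have := hDρ 1 g
      simp only [D] at this
      linarith
    have : ¬ ((1 / 2) ^ 0 ≤ d 1 g) := by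
      rw [pow_zero, not_le]; exact_mod_cast h1
    rw [hle_d, not_not] at this
    have h0 : g ∈ next V := by simpa [hU0] using this
    have h1 : (1 : G) ∈ next V := by rw [← hU0]; exact hone 0
    simpa using hn3 V hV _ h0 _ h1 _ h1

namespace LeftPseudometric

variable {G : Type u} [Group G] [TopologicalSpace G]

instance : CoeFun (LeftPseudometric G) fun _ => G → G → ℝ := ⟨toFun⟩

/-- The zero pseudometric. -/
instance : Zero (LeftPseudometric G) :=
  ⟨⟨fun _ _ => 0, by simp, by simp, by simp, by simp, by simp, by simp, by simp +contextual⟩⟩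

@[simp] theorem zero_apply (x y : G) : (0 : LeftPseudometric G) x y = 0 := rfl

variable (ρ : LeftPseudometric G)

theorem abs_sub_le (x y z : G) : |ρ x y - ρ x z| ≤ ρ y z := by
  rw [abs_le]
  have h1 := ρ.triangle' x y z
  have h2 := ρ.triangle' x z y
  have h3 := ρ.symm' y z
  constructor <;> linarith

theorem one_inv_mul (x y : G) : ρ 1 (x⁻¹ * y) = ρ x y := by
  have := ρ.mul_left' x 1 (x⁻¹ * y)
  rw [← this]; simp

theorem inv_mul_one (g a : G) : ρ g⁻¹ a = ρ 1 (g * a) := by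
  rw [← ρ.mul_left' g]; simp

theorem continuous_right [IsTopologicalGroup G] (x : G) : Continuous fun y => ρ x y := by
  rw [continuous_iff_continuousAt]
  intro y
  rw [ContinuousAt, Metric.tendsto_nhds]
  intro ε hε
  have h1 : Tendsto (fun z : G => y⁻¹ * z) (𝓝 y) (𝓝 1) := by
    have : Continuous fun z : G => y⁻¹ * z := by fun_prop
    simpa using this.tendsto y
  filter_upwards [h1.eventually (ρ.eventually_lt' ε hε)] with z hz
  rw [ρ.one_inv_mul] at hz
  rw [Real.dist_eq, abs_sub_comm]
  exact (ρ.abs_sub_le x y z).trans_lt hz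

end LeftPseudometric

/-! ### The normed space with basis `M ∪ {e}` -/

/-- Pairs `(f, α)` of a function on `M` and a real number which serve as the test functionals
defining the norm of `FreeSpace M`. -/
structure IsTest {M : Type u} [MetricSpace M] (f : M → ℝ) (α : ℝ) : Prop where
  abs_le_one : ∀ m, |f m| ≤ 1
  abs_sub_le_two : ∀ m, |f m - α| ≤ 2
  abs_le_three : |α| ≤ 3
  lipschitz : ∀ m m', |f m - f m'| ≤ dist m m'

/-- The real vector space with basis `M ∪ {e}`, where `e` is an additional vector. -/
def FreeSpace (M : Type u) : Type u := (M →₀ ℝ) × ℝ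

namespace FreeSpace

variable {M : Type u}

noncomputable instance : AddCommGroup (FreeSpace M) := inferInstanceAs (AddCommGroup ((M →₀ ℝ) × ℝ))
noncomputable instance : Module ℝ (FreeSpace M) := inferInstanceAs (Module ℝ ((M →₀ ℝ) × ℝ))

/-- The coefficients of a vector at the basis vectors from `M`. -/
noncomputable def coeffs : FreeSpace M →ₗ[ℝ] (M →₀ ℝ) := LinearMap.fst ℝ (M →₀ ℝ) ℝ

/-- The coefficient of a vector at `e`. -/
noncomputable def unitCoeff : FreeSpace M →ₗ[ℝ] ℝ := LinearMap.snd ℝ (M →₀ ℝ) ℝ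

/-- The vector with given coefficients. -/
noncomputable def mk (v : M →₀ ℝ) (s : ℝ) : FreeSpace M := (v, s)

/-- The basis vector `e`. -/
noncomputable def unit : FreeSpace M := mk 0 1

/-- The basis vector of a point. -/
noncomputable def of (m : M) : FreeSpace M := mk (Finsupp.single m 1) 0

@[simp] theorem coeffs_mk (v : M →₀ ℝ) (s : ℝ) : coeffs (mk v s) = v := rfl
@[simp] theorem unitCoeff_mk (v : M →₀ ℝ) (s : ℝ) : unitCoeff (mk v s) = s := rfl
@[simp] theorem coeffs_unit : coeffs (unit : FreeSpace M) = 0 := rfl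
@[simp] theorem unitCoeff_unit : unitCoeff (unit : FreeSpace M) = 1 := rfl
@[simp] theorem coeffs_of (m : M) : coeffs (of m) = Finsupp.single m 1 := rfl
@[simp] theorem unitCoeff_of (m : M) : unitCoeff (of m) = 0 := rfl

theorem ext {v w : FreeSpace M} (h : coeffs v = coeffs w) (h' : unitCoeff v = unitCoeff w) :
    v = w := Prod.ext h h'

theorem of_injective : Function.Injective (of : M → FreeSpace M) := fun m m' h => by
  have := congrArg coeffs h
  simpa using Finsupp.single_left_injective one_ne_zero this

theorem unit_ne_zero : (unit : FreeSpace M) ≠ 0 := fun h => by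
  simpa using congrArg unitCoeff h

theorem eq_sum (v : FreeSpace M) :
    v = (coeffs v).sum (fun m c => c • of m) + unitCoeff v • unit := by
  refine ext ?_ ?_
  · simp only [map_add, map_smul, coeffs_unit, smul_zero, add_zero, map_finsuppSum, coeffs_of]
    simp
  · simp [map_finsuppSum]

/-- The linear functional with prescribed values on the basis. -/
noncomputable def pair (f : M → ℝ) (α : ℝ) : FreeSpace M →ₗ[ℝ] ℝ :=
  Finsupp.linearCombination ℝ f ∘ₗ coeffs + α • unitCoeff

theorem pair_apply (f : M → ℝ) (α : ℝ) (v : FreeSpace M) :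
    pair f α v = (∑ m ∈ (coeffs v).support, coeffs v m * f m) + α * unitCoeff v := by
  simp [pair, Finsupp.linearCombination_apply, Finsupp.sum]

@[simp] theorem pair_of (f : M → ℝ) (α : ℝ) (m : M) : pair f α (of m) = f m := by
  simp [pair]

@[simp] theorem pair_unit (f : M → ℝ) (α : ℝ) : pair f α (unit : FreeSpace M) = α := by
  simp [pair]

variable [MetricSpace M]

/-- The index type of the test functionals. -/
def Test (M : Type u) [MetricSpace M] : Type u := {p : (M → ℝ) × ℝ // IsTest p.1 p.2}

instance : Nonempty (Test M) := ⟨⟨(0, 0), by constructor <;> simp⟩⟩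

noncomputable instance : Norm (FreeSpace M) := ⟨fun v => ⨆ p : Test M, |pair p.1.1 p.1.2 v|⟩

theorem norm_def (v : FreeSpace M) : ‖v‖ = ⨆ p : Test M, |pair p.1.1 p.1.2 v| := rfl

theorem bddAbove (v : FreeSpace M) :
    BddAbove (Set.range fun p : Test M => |pair p.1.1 p.1.2 v|) := by
  refine ⟨(∑ m ∈ (coeffs v).support, |coeffs v m|) + 3 * |unitCoeff v|, ?_⟩
  rintro _ ⟨⟨⟨f, α⟩, h⟩, rfl⟩
  simp only [pair_apply]
  refine (abs_add_le _ _).trans (add_le_add ((Finset.abs_sum_le_sum_abs _ _).trans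
    (Finset.sum_le_sum fun m _ => ?_)) ?_)
  · rw [abs_mul]
    exact mul_le_of_le_one_right (abs_nonneg _) (h.abs_le_one m)
  · rw [abs_mul]
    exact mul_le_mul_of_nonneg_right h.abs_le_three (abs_nonneg _)

theorem abs_pair_le {f : M → ℝ} {α : ℝ} (h : IsTest f α) (v : FreeSpace M) :
    |pair f α v| ≤ ‖v‖ :=
  le_ciSup (bddAbove v) (⟨(f, α), h⟩ : Test M)

theorem norm_le {v : FreeSpace M} {c : ℝ} (h : ∀ f α, IsTest f α → |pair f α v| ≤ c) : ‖v‖ ≤ c :=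
  ciSup_le fun p => h _ _ p.2

/-- Indicator functions on finite sets can be approximated by Lipschitz functions. -/
theorem exists_bump (s A : Finset M) (hA : A ⊆ s) :
    ∃ γ : ℝ, 0 < γ ∧ γ ≤ 1 ∧ ∃ g : M → ℝ, (∀ m, 0 ≤ g m) ∧ (∀ m, g m ≤ γ) ∧
      (∀ m m', |g m - g m'| ≤ dist m m') ∧ (∀ m ∈ A, g m = γ) ∧ ∀ m ∈ s, m ∉ A → g m = 0 := by
  classical
  rcases A.eq_empty_or_nonempty with rfl | hne
  · exact ⟨1, one_pos, le_rfl, fun _ => 0, by simp⟩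
  have hclosed : IsClosed (A : Set M) := A.finite_toSet.isClosed
  have hpos : ∀ m ∈ s \ A, 0 < Metric.infDist m (A : Set M) := by
    intro m hm
    rw [Finset.mem_sdiff] at hm
    exact (hclosed.notMem_iff_infDist_pos (by simpa using hne)).1 (by simpa using hm.2)
  obtain ⟨γ, hγ, hγ'⟩ : ∃ γ : ℝ, 0 < γ ∧ ∀ m ∈ s \ A, γ ≤ Metric.infDist m (A : Set M) := by
    rcases (s \ A).eq_empty_or_nonempty with h | h
    · exact ⟨1, one_pos, by simp [h]⟩
    · obtain ⟨m, hm, hmin⟩ := (s \ A).exists_min_image (fun m => Metric.infDist m (A : Set M)) h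
      exact ⟨_, hpos m hm, hmin⟩
  refine ⟨min γ 1, lt_min hγ one_pos, min_le_right _ _,
    fun m => min γ 1 - min (min γ 1) (Metric.infDist m (A : Set M)), ?_, ?_, ?_, ?_, ?_⟩
  · intro m; simp
  · intro m
    simp only [sub_le_self_iff]
    exact le_min (le_min hγ.le zero_le_one) Metric.infDist_nonneg
  · intro m m'
    have h1 := Metric.infDist_le_infDist_add_dist (s := (A : Set M)) (x := m) (y := m')
    have h2 := Metric.infDist_le_infDist_add_dist (s := (A : Set M)) (x := m') (y := m)
    rw [dist_comm] at h2
    have h3 := abs_min_sub_min_le_max (min γ 1) (Metric.infDist m' (A : Set M)) (min γ 1)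
      (Metric.infDist m (A : Set M))
    have h4 : |Metric.infDist m' (A : Set M) - Metric.infDist m (A : Set M)| ≤ dist m m' := by
      rw [abs_le]; constructor <;> linarith
    have h5 : |min γ 1 - min γ 1| ≤ dist m m' := by simp
    have := h3.trans (max_le h5 h4)
    rw [show min γ 1 - min (min γ 1) (Metric.infDist m (A : Set M)) -
      (min γ 1 - min (min γ 1) (Metric.infDist m' (A : Set M))) =
      min (min γ 1) (Metric.infDist m' (A : Set M)) -
      min (min γ 1) (Metric.infDist m (A : Set M)) by ring]
    exact this
  · intro m hm
    have h0 : Metric.infDist m (A : Set M) = 0 := Metric.infDist_zero_of_mem (Finset.mem_coe.2 hm)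
    have h1 : 0 ≤ min γ 1 := le_min hγ.le zero_le_one
    simp only [h0, min_eq_right h1, sub_zero]
  · intro m hm hm'
    have := hγ' m (by simp [hm, hm'])
    simp only [min_eq_left ((min_le_left _ _).trans this), sub_self]

/-- Tests separate vectors: `(0, 1)` reads off the coefficient at `e`, and a bump at one support
point, vanishing at the others, reads off the coefficient there. -/
theorem eq_zero_of_norm_eq_zero {v : FreeSpace M} (h : ‖v‖ = 0) : v = 0 := by
  classical
  have key : ∀ f α, IsTest f α → pair f α v = 0 := fun f α hf => by
    have := abs_pair_le hf v
    rw [h] at this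
    exact abs_nonpos_iff.1 this
  have h0 : unitCoeff v = 0 := by
    have := key (fun _ => 0) 1 ⟨by simp, by simp, by simp, by simp⟩
    rw [pair_apply] at this
    simpa using this
  refine ext (Finsupp.ext fun m => ?_) (by simpa using h0)
  by_contra hm
  have hm' : m ∈ (coeffs v).support := by simpa using hm
  obtain ⟨γ, hγ, hγ1, g, g0, gγ, gl, gA, gs⟩ :=
    exists_bump (coeffs v).support {m} (by simpa using hm)
  have hg : IsTest g 0 := by
    refine ⟨fun m => ?_, fun m => ?_, by simp, gl⟩
    · rw [abs_of_nonneg (g0 m)]; linarith [gγ m]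
    · rw [sub_zero, abs_of_nonneg (g0 m)]; linarith [gγ m]
  have := key g 0 hg
  rw [pair_apply, Finset.sum_eq_single m, gA m (by simp)] at this
  · simp [hγ.ne'] at this
    exact hm (by simpa using this)
  · intro j hj hjm
    rw [gs j hj (by simpa using hjm), mul_zero]
  · intro h; exact absurd hm' h

theorem norm_core : NormedSpace.Core ℝ (FreeSpace M) where
  norm_nonneg v := (abs_nonneg _).trans (abs_pair_le (f := fun _ : M => 0) (α := 0)
    ⟨by simp, by simp, by simp, by simp⟩ v)
  norm_smul c v := by
    simp only [norm_def, map_smul, smul_eq_mul, abs_mul, Real.norm_eq_abs]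
    rw [Real.mul_iSup_of_nonneg (abs_nonneg c)]
  norm_triangle v w := norm_le fun f α h => by
    rw [map_add]
    exact (abs_add_le _ _).trans (add_le_add (abs_pair_le h v) (abs_pair_le h w))
  norm_eq_zero_iff v := ⟨eq_zero_of_norm_eq_zero, by rintro rfl; simp [norm_def]⟩

noncomputable instance : NormedAddCommGroup (FreeSpace M) := NormedAddCommGroup.ofCore norm_core
noncomputable instance : NormedSpace ℝ (FreeSpace M) := NormedSpace.ofCore norm_core

theorem norm_of_sub_of (hM : ∀ m m' : M, dist m m' ≤ 1) (m m' : M) :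
    ‖of m - of m'‖ = dist m m' := by
  apply le_antisymm
  · refine norm_le fun f α h => ?_
    rw [map_sub, pair_of, pair_of]
    exact h.lipschitz m m'
  · have h : IsTest (fun j => dist j m') 0 := by
      refine ⟨fun j => ?_, fun j => ?_, by simp, fun j k => abs_dist_sub_le _ _ _⟩
      · rw [abs_of_nonneg dist_nonneg]; exact hM _ _
      · rw [sub_zero, abs_of_nonneg dist_nonneg]; linarith [hM j m']
    simpa [abs_of_nonneg] using abs_pair_le h (of m - of m')

theorem isometry_of (hM : ∀ m m' : M, dist m m' ≤ 1) : Isometry (of : M → FreeSpace M) :=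
  Isometry.of_dist_eq fun m m' => by rw [dist_eq_norm, norm_of_sub_of hM]

/-- This bound and the next two are preserved by linear isometries fixing `e`; `mem_simplex`
extracts from them that the vector lies in the simplex. -/
theorem norm_of_le (m : M) : ‖of m‖ ≤ 1 := norm_le fun f α h => by
  simpa using h.abs_le_one m

theorem norm_of_sub_unit_le (m : M) : ‖of m - unit‖ ≤ 2 := norm_le fun f α h => by
  simpa using h.abs_sub_le_two m

theorem le_norm_of_sub_unit (m : M) : 4 / 3 ≤ ‖of m - (1 / 3 : ℝ) • unit‖ := by
  have h : IsTest (fun _ : M => 1) (-1) :=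
    ⟨by simp, fun m => by norm_num, by norm_num, by simp⟩
  refine le_trans ?_ (abs_pair_le h _)
  rw [map_sub, map_smul, pair_of, pair_unit]
  norm_num

/-- The convex hull of the basis vectors from `M`. -/
def simplex (M : Type u) : Set (FreeSpace M) :=
  {v | unitCoeff v = 0 ∧ (∀ m, 0 ≤ coeffs v m) ∧ ∑ m ∈ (coeffs v).support, coeffs v m = 1}

/-- The relation between `s` and the coefficient sum turns the pairing into `∑ cₘ (f m - α / 3)`.
Recentring `f` at its maximum on the support leaves only the negative coefficients, of total mass at
most `N`, with a positive contribution. -/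
theorem pair_sub_le {v : FreeSpace M} {s N : ℝ} (hM : ∀ m m' : M, dist m m' ≤ 1)
    (hs : unitCoeff v = s) (h1 : ∑ m ∈ (coeffs v).support, coeffs v m = 1 - 3 * s)
    (hN : ∑ m ∈ (coeffs v).support with coeffs v m < 0, -coeffs v m ≤ N) (hN0 : 0 ≤ N)
    {f : M → ℝ} {α : ℝ} (h : IsTest f α) :
    pair f α (v - (1 / 3 : ℝ) • unit) ≤ 4 / 3 * |1 - 3 * s| + N := by
  classical
  set S := (coeffs v).support with hS
  have e1 : pair f α (v - (1 / 3 : ℝ) • unit) = ∑ m ∈ S, coeffs v m * (f m - α / 3) := by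
    rw [map_sub, map_smul, pair_unit, pair_apply, hs]
    simp only [mul_sub, Finset.sum_sub_distrib, ← Finset.sum_mul]
    rw [h1, smul_eq_mul]; ring
  rw [e1]
  -- Here `f - α / 3 = (2 / 3) f + (1 / 3) (f - α)`.
  have hb : ∀ m, |f m - α / 3| ≤ 4 / 3 := fun m => by
    have := h.abs_le_one m
    have := h.abs_sub_le_two m
    rw [abs_le] at *
    constructor <;> linarith
  rcases S.eq_empty_or_nonempty with h0 | hne
  · rw [h0]; simp only [Finset.sum_empty]; positivity
  obtain ⟨j, hj, hmax⟩ := S.exists_max_image f hne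
  have e2 : ∑ m ∈ S, coeffs v m * (f m - α / 3) =
      (1 - 3 * s) * (f j - α / 3) + ∑ m ∈ S, coeffs v m * (f m - f j) := by
    rw [← h1, Finset.sum_mul, ← Finset.sum_add_distrib]
    exact Finset.sum_congr rfl fun m _ => by ring
  rw [e2]
  refine add_le_add ?_ ?_
  · refine (le_abs_self _).trans ?_
    rw [abs_mul, mul_comm]
    exact mul_le_mul_of_nonneg_right (hb j) (abs_nonneg _)
  · refine le_trans ?_ hN
    rw [Finset.sum_filter]
    refine Finset.sum_le_sum fun m hm => ?_
    have h3 := hmax m hm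
    have h4 := (abs_le.1 (h.lipschitz m j)).1
    have h5 := hM m j
    split_ifs with hneg
    · nlinarith
    · push Not at hneg
      exact mul_nonpos_of_nonneg_of_nonpos hneg (by linarith)

/-- A metric condition forcing a vector to be a convex combination of points of `M`. -/
theorem mem_simplex (hM : ∀ m m' : M, dist m m' ≤ 1) {v : FreeSpace M} (h1 : ‖v‖ ≤ 1)
    (h2 : ‖v - unit‖ ≤ 2) (h3 : 4 / 3 ≤ ‖v - (1 / 3 : ℝ) • unit‖) : v ∈ simplex M := by
  classical
  set S := (coeffs v).support with hS
  set s := unitCoeff v with hs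
  have key1 : ∀ f α, IsTest f α → pair f α v ≤ 1 := fun f α h =>
    (le_abs_self _).trans ((abs_pair_le h v).trans h1)
  have key2 : ∀ f α, IsTest f α → α - 2 ≤ pair f α v := fun f α h => by
    have := (abs_le.1 ((abs_pair_le h (v - unit)).trans h2)).1
    rw [map_sub, pair_unit] at this
    linarith
  -- For `α = 3` the lower bound `α - 2` equals the upper bound `1`, so the pairing with `v` is
  -- determined exactly.
  have t0 : IsTest (fun _ : M => 1) 3 :=
    ⟨by simp, fun m => by norm_num, by norm_num, by simp⟩
  have hsum : ∑ m ∈ S, coeffs v m = 1 - 3 * s := by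
    have a1 := key1 _ _ t0
    have a2 := key2 _ _ t0
    rw [pair_apply] at a1 a2
    simp only [mul_one, ← hS, ← hs] at a1 a2
    linarith
  -- Lowering the extremal test by `γ` on `A` and at `e` must not raise the pairing above `1`; the
  -- loss is `γ` times the quantity in question.
  have hA : ∀ A ⊆ S, 0 ≤ s + ∑ m ∈ A, coeffs v m := by
    intro A hA
    obtain ⟨γ, hγ, hγ1, g, g0, gγ, gl, gA, gs⟩ := exists_bump S A hA
    have t : IsTest (fun m => 1 - g m) (3 - γ) := by
      refine ⟨fun m => ?_, fun m => ?_, ?_, fun m m' => ?_⟩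
      · have := g0 m; have := gγ m
        rw [abs_le]; constructor <;> linarith
      · have := g0 m; have := gγ m
        rw [abs_le]; constructor <;> linarith
      · rw [abs_le]; constructor <;> linarith
      · rw [show 1 - g m - (1 - g m') = -(g m - g m') by ring, abs_neg]; exact gl m m'
    have a1 := key1 _ _ t
    rw [pair_apply, ← hS, ← hs] at a1
    have e : ∑ m ∈ S, coeffs v m * (1 - g m) = (1 - 3 * s) - γ * ∑ m ∈ A, coeffs v m := by
      have e' : ∑ m ∈ A, coeffs v m * g m = ∑ m ∈ S, coeffs v m * g m :=
        Finset.sum_subset hA fun m hm hmA => by rw [gs m hm hmA, mul_zero]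
      have e'' : ∑ m ∈ A, coeffs v m * g m = γ * ∑ m ∈ A, coeffs v m := by
        rw [Finset.mul_sum]
        exact Finset.sum_congr rfl fun m hm => by rw [gA m hm, mul_comm]
      simp only [mul_sub, mul_one, Finset.sum_sub_distrib]
      rw [← e', e'', hsum]
    rw [e] at a1
    have : 0 ≤ γ * (s + ∑ m ∈ A, coeffs v m) := by linarith
    exact nonneg_of_mul_nonneg_right this hγ
  have hs0 : 0 ≤ s := by simpa using hA ∅ (by simp)
  have hN : ∑ m ∈ S with coeffs v m < 0, -coeffs v m ≤ s := by
    have := hA (S.filter fun m => coeffs v m < 0) (Finset.filter_subset _ _)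
    rw [Finset.sum_neg_distrib]; linarith
  -- This gives `s ≤ 1 / 2`, which settles the case `1 - 3 * s < 0` below: there the norm bound `5 *
  -- s - 4 / 3` stays under `4 / 3`.
  have hsplit : -s ≤ 1 - 3 * s := by
    rw [← hsum, ← Finset.sum_filter_add_sum_filter_not S (fun m => coeffs v m < 0)]
    rw [Finset.sum_neg_distrib] at hN
    have : 0 ≤ ∑ m ∈ S with ¬ coeffs v m < 0, coeffs v m :=
      Finset.sum_nonneg fun m hm => not_lt.1 (Finset.mem_filter.1 hm).2
    linarith
  have hle : ‖v - (1 / 3 : ℝ) • unit‖ ≤ 4 / 3 * |1 - 3 * s| + s := by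
    refine norm_le fun f α h => abs_le'.2 ⟨pair_sub_le hM rfl hsum hN hs0 h, ?_⟩
    have t : IsTest (fun m => -f m) (-α) := by
      refine ⟨fun m => ?_, fun m => ?_, ?_, fun m m' => ?_⟩
      · rw [abs_neg]; exact h.abs_le_one m
      · rw [← neg_sub', abs_neg]; exact h.abs_sub_le_two m
      · rw [abs_neg]; exact h.abs_le_three
      · rw [← neg_sub', abs_neg]; exact h.lipschitz m m'
    have := pair_sub_le hM rfl hsum hN hs0 t
    refine le_trans (le_of_eq ?_) this
    simp only [pair_apply, mul_neg, neg_mul, Finset.sum_neg_distrib]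
    ring
  have hs00 : s = 0 := by
    by_contra hne
    have hpos : 0 < s := lt_of_le_of_ne hs0 (Ne.symm hne)
    have := h3.trans hle
    rcases abs_cases (1 - 3 * s) with ⟨h, -⟩ | ⟨h, -⟩ <;> rw [h] at this <;> linarith
  refine ⟨hs00, fun m => ?_, by rw [hsum, hs00]; ring⟩
  by_contra hneg
  push Not at hneg
  have hm : m ∈ S := by simpa [hS] using hneg.ne
  have := hA {m} (by simpa using hm)
  rw [hs00] at this
  simp at this
  linarith

end FreeSpace

/-! ### Isometries of `M` and linear isometries fixing `e` -/

theorem continuous_isometryEquiv_iff {A X : Type u} [TopologicalSpace A] [PseudoEMetricSpace X]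
    {f : A → X ≃ᵢ X} : Continuous f ↔ ∀ x, Continuous fun a => f a x := by
  rw [continuous_induced_rng, continuous_pi_iff]; rfl

theorem continuous_linearIsometriesFixing_iff {A E : Type u} [TopologicalSpace A]
    [NormedAddCommGroup E] [NormedSpace ℝ E] {e : E} {f : A → linearIsometriesFixing E e} :
    Continuous f ↔ ∀ x, Continuous fun a => (f a : E ≃ₗᵢ[ℝ] E) x := by
  rw [continuous_induced_rng, continuous_induced_rng, continuous_pi_iff]; rfl

namespace FreeSpace

variable {M : Type u}

theorem eq_of_of_mem_simplex {v : FreeSpace M} (hv : v ∈ simplex M) {m : M}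
    (h : ∀ k, k ≠ m → coeffs v k = 0) : v = of m := by
  have e : coeffs v = Finsupp.single m (coeffs v m) := by
    ext k
    rcases eq_or_ne k m with rfl | hk
    · simp
    · rw [h k hk, Finsupp.single_eq_of_ne hk]
  have h1 : coeffs v m = 1 := by
    rw [← hv.2.2, Finset.sum_eq_single m (fun k _ hk => h k hk)]
    intro hm; simpa using hm
  refine ext ?_ (by simpa using hv.1)
  rw [e, h1, coeffs_of]

/-- The linear map induced by a bijection of `M`. -/
noncomputable def mapLinear (σ : M ≃ M) : FreeSpace M ≃ₗ[ℝ] FreeSpace M :=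
  LinearEquiv.prodCongr (Finsupp.domLCongr σ) (LinearEquiv.refl ℝ ℝ)

@[simp] theorem coeffs_mapLinear (σ : M ≃ M) (v : FreeSpace M) :
    coeffs (mapLinear σ v) = Finsupp.domLCongr (R := ℝ) σ (coeffs v) := rfl

@[simp] theorem unitCoeff_mapLinear (σ : M ≃ M) (v : FreeSpace M) :
    unitCoeff (mapLinear σ v) = unitCoeff v := rfl

@[simp] theorem mapLinear_of (σ : M ≃ M) (m : M) : mapLinear σ (of m) = of (σ m) :=
  ext (by simp) (by simp)

@[simp] theorem mapLinear_unit (σ : M ≃ M) : mapLinear σ (unit : FreeSpace M) = unit :=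
  ext (by simp) (by simp)

theorem mapLinear_apply (σ : M ≃ M) (v : FreeSpace M) : mapLinear σ v =
    (coeffs v).sum (fun m c => c • of (σ m)) + unitCoeff v • unit := by
  conv_lhs => rw [eq_sum v]
  simp [map_finsuppSum]

theorem pair_mapLinear (σ : M ≃ M) (f : M → ℝ) (α : ℝ) (v : FreeSpace M) :
    pair f α (mapLinear σ v) = pair (f ∘ σ) α v := by
  conv_rhs => rw [eq_sum v]
  simp [mapLinear_apply, map_finsuppSum]

theorem not_finiteDimensional [Infinite M] : ¬ FiniteDimensional ℝ (FreeSpace M) := by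
  intro h
  have hsurj : Function.Surjective (coeffs : FreeSpace M →ₗ[ℝ] _) := fun v => ⟨mk v 0, rfl⟩
  have h2 : Module.Finite ℝ (M →₀ ℝ) := Module.Finite.of_surjective _ hsurj
  rcases Module.finite_finsupp_self_iff.1 h2 with h3 | h3
  · exact not_subsingleton ℝ h3
  · exact not_finite M

variable [MetricSpace M]

theorem map_of_mem_simplex (hM : ∀ m m' : M, dist m m' ≤ 1)
    (T : FreeSpace M ≃ₗᵢ[ℝ] FreeSpace M) (hT : T unit = unit) (m : M) : T (of m) ∈ simplex M := by
  refine mem_simplex hM ?_ ?_ ?_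
  · rw [T.norm_map]; exact norm_of_le m
  · rw [← hT, ← map_sub, T.norm_map]; exact norm_of_sub_unit_le m
  · rw [← hT, ← map_smul, ← map_sub, T.norm_map]; exact le_norm_of_sub_unit m

/-- Vertices are extreme points. Writing `T (of m)` as a convex combination of vertices and applying
`T.symm` writes `of m` as a convex combination of points of the simplex, so every term of positive
weight equals `of m`. -/
theorem exists_map_of_eq_of (hM : ∀ m m' : M, dist m m' ≤ 1)
    (T : FreeSpace M ≃ₗᵢ[ℝ] FreeSpace M) (hT : T unit = unit) (m : M) :
    ∃ j, of j = T (of m) := by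
  classical
  have hT' : T.symm unit = unit := by rw [T.symm_apply_eq, hT]
  obtain ⟨h1, h2, h3⟩ := map_of_mem_simplex hM T hT m
  set w := T (of m) with hw
  obtain ⟨j, hj⟩ : (coeffs w).support.Nonempty := by
    by_contra h
    rw [Finset.not_nonempty_iff_eq_empty] at h
    simp [h] at h3
  have hjpos : 0 < coeffs w j := lt_of_le_of_ne (h2 j) (Ne.symm (by simpa using hj))
  have hsum : of m = ∑ k ∈ (coeffs w).support, coeffs w k • T.symm (of k) := by
    have : T.symm w = of m := by rw [hw, T.symm_apply_apply]
    rw [← this]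
    conv_lhs => rw [eq_sum w, h1, zero_smul, add_zero, Finsupp.sum, map_sum]
    simp only [map_smul]
  refine ⟨j, ?_⟩
  rw [hw, ← T.symm_apply_eq]
  refine eq_of_of_mem_simplex (map_of_mem_simplex hM T.symm hT' j) fun k hk => ?_
  have h0 := congrArg (fun v => coeffs v k) hsum
  simp only [coeffs_of, map_sum, map_smul, Finsupp.coe_finsetSum, Finset.sum_apply,
    Finsupp.smul_apply, smul_eq_mul, Finsupp.single_eq_of_ne hk] at h0
  have := (Finset.sum_eq_zero_iff_of_nonneg (fun i _ =>
    mul_nonneg (h2 i) ((map_of_mem_simplex hM T.symm hT' i).2.1 k))).1 h0.symm j hj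
  exact (mul_eq_zero.1 this).resolve_left hjpos.ne'

theorem norm_mapLinear_le (σ : M ≃ᵢ M) (v : FreeSpace M) : ‖mapLinear σ.toEquiv v‖ ≤ ‖v‖ :=
  norm_le fun f α h => by
    rw [pair_mapLinear]
    refine abs_pair_le ⟨fun m => h.abs_le_one _, fun m => h.abs_sub_le_two _, h.abs_le_three,
      fun m m' => ?_⟩ v
    exact (h.lipschitz _ _).trans (σ.isometry.dist_eq m m').le

/-- The linear isometry induced by an isometry of `M`. -/
noncomputable def mapIso (σ : M ≃ᵢ M) : FreeSpace M ≃ₗᵢ[ℝ] FreeSpace M where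
  toLinearEquiv := mapLinear σ.toEquiv
  norm_map' v := by
    refine le_antisymm (norm_mapLinear_le σ v) ?_
    have h := norm_mapLinear_le σ.symm (mapLinear σ.toEquiv v)
    have e : mapLinear σ.symm.toEquiv (mapLinear σ.toEquiv v) = v := by
      conv_rhs => rw [eq_sum v]
      simp [mapLinear_apply σ.toEquiv, map_finsuppSum]
    rwa [e] at h

theorem mapIso_apply (σ : M ≃ᵢ M) (v : FreeSpace M) : mapIso σ v =
    (coeffs v).sum (fun m c => c • of (σ m)) + unitCoeff v • unit := mapLinear_apply _ v

@[simp] theorem mapIso_of (σ : M ≃ᵢ M) (m : M) : mapIso σ (of m) = of (σ m) :=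
  mapLinear_of _ m

@[simp] theorem mapIso_unit (σ : M ≃ᵢ M) : mapIso σ (unit : FreeSpace M) = unit :=
  mapLinear_unit _

theorem linearIsometryEquiv_ext {S T : FreeSpace M ≃ₗᵢ[ℝ] FreeSpace M}
    (h : ∀ m, S (of m) = T (of m)) (h' : S unit = T unit) : S = T := by
  ext v
  rw [eq_sum v]
  simp [map_finsuppSum, h, h']

/-- The homomorphism from isometries of `M` to linear isometries of `FreeSpace M` fixing `e`. -/
noncomputable def mapIsoHom (M : Type u) [MetricSpace M] :
    (M ≃ᵢ M) →* linearIsometriesFixing (FreeSpace M) unit where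
  toFun σ := ⟨mapIso σ, mapIso_unit σ⟩
  map_one' := Subtype.ext (linearIsometryEquiv_ext (fun m => by simp) (by simp))
  map_mul' σ τ := Subtype.ext (linearIsometryEquiv_ext (fun m => by
    change _ = mapIso σ (mapIso τ (of m))
    simp) (by
    change _ = mapIso σ (mapIso τ unit)
    simp))

theorem mapIsoHom_injective : Function.Injective (mapIsoHom M) := fun σ τ h => by
  ext m
  have : mapIso σ (of m) = mapIso τ (of m) :=
    congrArg (fun T => (T : _ ≃ₗᵢ[ℝ] _) (of m)) (congrArg Subtype.val h)
  simpa using of_injective (by simpa using this)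

theorem mapIsoHom_surjective (hM : ∀ m m' : M, dist m m' ≤ 1) :
    Function.Surjective (mapIsoHom M) := by
  rintro ⟨T, hT : T unit = unit⟩
  have hT' : T.symm unit = unit := by rw [T.symm_apply_eq, hT]
  choose f hf using exists_map_of_eq_of hM T hT
  choose g hg using exists_map_of_eq_of hM T.symm hT'
  let σ : M ≃ᵢ M := IsometryEquiv.mk'  f g
    (fun m => of_injective (by rw [hf, hg, T.apply_symm_apply]))
    (Isometry.of_dist_eq fun m m' => by
      rw [← (isometry_of hM).dist_eq, hf, hf, T.dist_map, (isometry_of hM).dist_eq])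
  refine ⟨σ, Subtype.ext (linearIsometryEquiv_ext (fun m => ?_) ?_)⟩
  · exact (mapIso_of σ m).trans (hf m)
  · exact (mapIso_unit σ).trans hT.symm

/-- Isometries of `M` are the same as linear isometries of `FreeSpace M` fixing `e`. -/
noncomputable def mapIsoEquiv (hM : ∀ m m' : M, dist m m' ≤ 1) :
    (M ≃ᵢ M) ≃* linearIsometriesFixing (FreeSpace M) unit :=
  MulEquiv.ofBijective (mapIsoHom M) ⟨mapIsoHom_injective, mapIsoHom_surjective hM⟩

theorem mapIsoEquiv_coe (hM : ∀ m m' : M, dist m m' ≤ 1) (σ : M ≃ᵢ M) :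
    (mapIsoEquiv hM σ : FreeSpace M ≃ₗᵢ[ℝ] FreeSpace M) = mapIso σ := rfl

theorem of_mapIsoEquiv_symm (hM : ∀ m m' : M, dist m m' ≤ 1)
    (T : linearIsometriesFixing (FreeSpace M) unit) (m : M) :
    of ((mapIsoEquiv hM).symm T m) = (T : FreeSpace M ≃ₗᵢ[ℝ] FreeSpace M) (of m) := by
  conv_rhs => rw [← (mapIsoEquiv hM).apply_symm_apply T]
  rw [mapIsoEquiv_coe, mapIso_of]

theorem continuous_mapIsoEquiv (hM : ∀ m m' : M, dist m m' ≤ 1) :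
    Continuous (mapIsoEquiv hM) := by
  refine continuous_linearIsometriesFixing_iff.2 fun v => ?_
  have h1 (m : M) : Continuous fun σ : M ≃ᵢ M => of (σ m) :=
    (isometry_of hM).continuous.comp (continuous_isometryEquiv_iff.1 continuous_id m)
  have h2 : Continuous fun σ : M ≃ᵢ M => ∑ m ∈ (coeffs v).support, coeffs v m • of (σ m) :=
    continuous_finsetSum _ fun m _ => (continuous_const_smul (coeffs v m)).comp (h1 m)
  have h3 : Continuous fun σ : M ≃ᵢ M =>
      (∑ m ∈ (coeffs v).support, coeffs v m • of (σ m)) + unitCoeff v • unit :=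
    h2.add continuous_const
  exact h3.congr fun σ => (mapIso_apply σ v).symm

theorem continuous_mapIsoEquiv_symm (hM : ∀ m m' : M, dist m m' ≤ 1) :
    Continuous (mapIsoEquiv hM).symm := by
  refine continuous_isometryEquiv_iff.2 fun m => ?_
  rw [(isometry_of hM).isEmbedding.continuous_iff]
  refine (continuous_linearIsometriesFixing_iff.1 continuous_id (of m)).congr fun T => ?_
  exact (of_mapIsoEquiv_symm hM T m).symm

/-- Isometries of `M` are the same as linear isometries of `FreeSpace M` fixing `e`, as
topological groups. -/
noncomputable def mapIsoContinuousMulEquiv (hM : ∀ m m' : M, dist m m' ≤ 1) :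
    (M ≃ᵢ M) ≃ₜ* linearIsometriesFixing (FreeSpace M) unit where
  toMulEquiv := mapIsoEquiv hM
  continuous_toFun := continuous_mapIsoEquiv hM
  continuous_invFun := continuous_mapIsoEquiv_symm hM

/-- The density of the space of finite combinations of a dense set. -/
theorem exists_dense {D : Set M} (hD : Dense D) (hM : ∀ m m' : M, dist m m' ≤ 1)
    {β : Cardinal.{u}} (hβ : ℵ₀ ≤ β) (hc : #D ≤ β) :
    ∃ S : Set (FreeSpace M), Dense S ∧ #S ≤ β := by
  let b : Option D → FreeSpace M := fun o => o.elim unit fun m => of m.1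
  let F : List (ℚ × Option D) → FreeSpace M := fun l => (l.map fun p => (p.1 : ℝ) • b p.2).sum
  refine ⟨Set.range F, ?_, ?_⟩
  · have hadd : ∀ v ∈ closure (Set.range F), ∀ w ∈ closure (Set.range F),
        v + w ∈ closure (Set.range F) := fun v hv w hw =>
      map_mem_closure₂ continuous_add hv hw (by
        rintro _ ⟨l, rfl⟩ _ ⟨l', rfl⟩
        exact ⟨l ++ l', by simp [F]⟩)
    have hsmul : ∀ (r : ℝ) (v), v ∈ closure (Set.range b) →
        r • v ∈ closure (Set.range F) := fun r v hv =>
      map_mem_closure₂ (f := fun (r : ℝ) (v : FreeSpace M) => r • v) continuous_smul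
        (Rat.denseRange_cast r) hv (by
          rintro _ ⟨q, rfl⟩ _ ⟨o, rfl⟩
          exact ⟨[(q, o)], by simp [F]⟩)
    have hof : ∀ m, of m ∈ closure (Set.range b) := fun m =>
      map_mem_closure (isometry_of hM).continuous (hD m) fun d hd => ⟨some ⟨d, hd⟩, rfl⟩
    have h0 : (0 : FreeSpace M) ∈ closure (Set.range F) := subset_closure ⟨[], rfl⟩
    intro v
    rw [eq_sum v]
    refine hadd _ ?_ _ (hsmul _ _ (subset_closure ⟨none, rfl⟩))
    exact Finset.sum_induction _ (· ∈ closure (Set.range F)) (fun v w hv hw => hadd v hv w hw) h0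
      fun m _ => hsmul _ _ (hof m)
  · refine mk_range_le.trans ((mk_list_le_max _).trans (max_le hβ ?_))
    rw [mk_prod, lift_uzero, mk_option]
    refine mul_le_of_le hβ ?_ (add_le_of_le hβ hc (one_le_aleph0.trans hβ))
    exact (lift_le_aleph0.2 mk_le_aleph0).trans hβ

end FreeSpace

/-! ### Weight estimates from dense and from separated sets -/

theorem topWeight_le_of_dense {X : Type u} [PseudoMetricSpace X] {S : Set X} (hS : Dense S)
    {β : Cardinal.{u}} (hβ : ℵ₀ ≤ β) (hc : #S ≤ β) : topWeight X ≤ β := by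
  let F : S × ℕ → Set X := fun p => Metric.ball p.1.1 (1 / (p.2 + 1))
  have hb : TopologicalSpace.IsTopologicalBasis (Set.range F) := by
    refine TopologicalSpace.isTopologicalBasis_of_isOpen_of_nhds ?_ ?_
    · rintro _ ⟨p, rfl⟩; exact Metric.isOpen_ball
    · intro x U hx hU
      obtain ⟨ε, hε, hball⟩ := Metric.isOpen_iff.1 hU x hx
      obtain ⟨n, hn⟩ := exists_nat_one_div_lt (half_pos hε)
      obtain ⟨s, hs, hd⟩ := Metric.dense_iff.1 hS x (1 / (n + 1)) (by positivity)
      refine ⟨_, ⟨(⟨s, hd⟩, n), rfl⟩, ?_, ?_⟩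
      · simpa [F, dist_comm] using hs
      · intro y hy
        apply hball
        have h1 : dist y s < 1 / (n + 1) := hy
        have h2 : dist s x < 1 / (n + 1) := hs
        have := dist_triangle y s x
        rw [Metric.mem_ball]; linarith
  have h : topWeight X ≤ #(Set.range F) := csInf_le' ⟨_, hb, rfl⟩
  refine h.trans (mk_range_le.trans ?_)
  rw [mk_prod, lift_uzero, mk_nat, lift_aleph0]
  exact mul_le_of_le hβ hc hβ

theorem le_topWeight_of_separated {X W : Type u} [PseudoMetricSpace X] (f : W → X) {r : ℝ}
    (hr : 0 < r) (hf : ∀ w w', w ≠ w' → r ≤ dist (f w) (f w')) : #W ≤ topWeight X := by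
  unfold topWeight
  refine le_csInf ⟨_, {s : Set X | IsOpen s}, TopologicalSpace.isTopologicalBasis_opens, rfl⟩ ?_
  rintro c ⟨B, hB, rfl⟩
  have : ∀ w, ∃ b ∈ B, f w ∈ b ∧ b ⊆ Metric.ball (f w) r := fun w =>
    hB.exists_subset_of_mem_open (Metric.mem_ball_self hr) Metric.isOpen_ball
  choose b hbB hb hbs using this
  refine mk_le_of_injective (f := fun w => (⟨b w, hbB w⟩ : B)) fun w w' h => ?_
  by_contra hne
  have h1 : b w = b w' := congrArg Subtype.val h
  have h2 := hbs w' (h1 ▸ hb w)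
  exact absurd (hf w w' hne) (not_le.2 h2)

/-! ### Isometries of the complement of a ray -/

section RayComplement

variable {E : Type u} [NormedAddCommGroup E]

/-- An isometry of a dense subspace extends to the completion. -/
theorem exists_isometryEquiv_completion {U : Set E} (hU : Dense U) (f : U ≃ᵢ U) :
    ∃ A : UniformSpace.Completion E ≃ᵢ UniformSpace.Completion E,
      ∀ u : U, A ((u : E) : UniformSpace.Completion E) =
        ((f u : E) : UniformSpace.Completion E) := by
  let j : U → UniformSpace.Completion E := fun u => ((u : E) : UniformSpace.Completion E)
  have hj : Isometry j := UniformSpace.Completion.coe_isometry.comp isometry_subtype_coe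
  have hd : DenseRange j :=
    UniformSpace.Completion.denseRange_coe.comp hU.denseRange_val
      (UniformSpace.Completion.continuous_coe E)
  let pkg : AbstractCompletion U :=
    { space := UniformSpace.Completion E
      coe := j
      uniformStruct := inferInstance
      complete := inferInstance
      separation := inferInstance
      isUniformInducing := hj.isUniformInducing
      dense := hd }
  have hmap : ∀ (h : U ≃ᵢ U) (u : U), pkg.map pkg h (j u) = j (h u) := fun h u =>
    pkg.map_coe pkg h.isometry.uniformContinuous u
  have hcont : ∀ h : U ≃ᵢ U, Continuous (pkg.map pkg h) := fun h => pkg.continuous_map pkg h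
  have hiso : ∀ h : U ≃ᵢ U, Isometry (pkg.map pkg h) := fun h => by
    refine Isometry.of_dist_eq fun x y => ?_
    refine hd.induction_on₂ (p := fun x y => dist (pkg.map pkg h x) (pkg.map pkg h y) = dist x y)
      ?_ (fun a b => ?_) x y
    · exact isClosed_eq (((hcont h).comp continuous_fst).dist ((hcont h).comp continuous_snd))
        (continuous_fst.dist continuous_snd)
    · rw [hmap, hmap, hj.dist_eq, hj.dist_eq, h.dist_eq]
  have hinv : ∀ x, pkg.map pkg f (pkg.map pkg f.symm x) = x := fun x => by
    refine hd.induction_on x (isClosed_eq ((hcont f).comp (hcont f.symm)) continuous_id) fun u => ?_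
    rw [hmap, hmap, f.apply_symm_apply]
  exact ⟨IsometryEquiv.mk' (pkg.map pkg f) (pkg.map pkg f.symm) hinv (hiso f), hmap f⟩

variable [NormedSpace ℝ E]

/-- The extension `A` to the completion must be shown to preserve `E`. For `x` outside `U` the point
`-x` lies in `U`, and preservation of the midpoint `0` gives `A x = 2 A 0 - A (-x)`, which lies in
`E`. -/
theorem exists_isometryEquiv_extending {U : Set E} (hU : Dense U) (h0 : (0 : E) ∈ U)
    (hneg : ∀ x, x ∈ U ∨ -x ∈ U) (f : U ≃ᵢ U) : ∃ g : E ≃ᵢ E, ∀ u : U, g u = f u := by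
  obtain ⟨A, hA⟩ := exists_isometryEquiv_completion hU f
  have hA' : ∀ u : U, A.symm ((u : E) : UniformSpace.Completion E) = (f.symm u : E) := fun u => by
    rw [A.symm_apply_eq, hA, f.apply_symm_apply]
  have key : ∀ (B : UniformSpace.Completion E ≃ᵢ UniformSpace.Completion E) (h : U ≃ᵢ U),
      (∀ u : U, B ((u : E) : UniformSpace.Completion E) = (h u : E)) →
      ∀ x : E, ∃ y : E, (y : UniformSpace.Completion E) = B x := by
    intro B h hB x
    rcases hneg x with hx | hx
    · exact ⟨h ⟨x, hx⟩, (hB ⟨x, hx⟩).symm⟩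
    · refine ⟨(2 : ℝ) • (h ⟨0, h0⟩ : E) - h ⟨-x, hx⟩, ?_⟩
      have hm := B.map_midpoint (x : UniformSpace.Completion E) (-x)
      rw [midpoint_self_neg] at hm
      have e0 : B 0 = (h ⟨0, h0⟩ : E) := by
        rw [← hB ⟨0, h0⟩, UniformSpace.Completion.coe_zero]
      have e1 : B (-x) = (h ⟨-x, hx⟩ : E) := by
        rw [← hB ⟨-x, hx⟩, UniformSpace.Completion.coe_neg]
      rw [UniformSpace.Completion.coe_sub, UniformSpace.Completion.coe_smul, ← e0, ← e1, hm,
        midpoint_eq_smul_add, smul_smul]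
      simp
  choose g hg using key A f hA
  choose g' hg' using key A.symm f.symm hA'
  have hco : Function.Injective ((↑) : E → UniformSpace.Completion E) :=
    UniformSpace.Completion.coe_isometry.injective
  refine ⟨IsometryEquiv.mk' g g' (fun x => hco ?_) (Isometry.of_dist_eq fun x y => ?_),
    fun u => hco ?_⟩
  · rw [hg, hg', A.apply_symm_apply]
  · rw [← UniformSpace.Completion.coe_isometry.dist_eq, hg, hg, A.dist_eq,
      UniformSpace.Completion.coe_isometry.dist_eq]
  · exact (hg u).trans (hA u)

/-- The complement of the ray which starts at `e` in the direction of `e`. -/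
def rayCompl (e : E) : Set E := {x | ∀ t : ℝ, 1 ≤ t → t • e ≠ x}

theorem zero_mem_rayCompl {e : E} (he : e ≠ 0) : (0 : E) ∈ rayCompl e := fun t ht h => by
  rcases smul_eq_zero.1 h with h | h
  · linarith
  · exact he h

theorem mem_or_neg_mem_rayCompl {e : E} (he : e ≠ 0) (x : E) :
    x ∈ rayCompl e ∨ -x ∈ rayCompl e := by
  by_contra! h
  simp only [rayCompl, Set.mem_ofPred_eq, not_forall, not_not] at h
  obtain ⟨⟨t, ht, h1⟩, ⟨s, hs, h2⟩⟩ := h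
  have : (t + s) • e = 0 := by rw [add_smul, h1, h2, add_neg_cancel]
  rcases smul_eq_zero.1 this with h | h
  · linarith
  · exact he h

theorem isOpen_rayCompl {e : E} (he : e ≠ 0) : IsOpen (rayCompl e) := by
  have h := (isClosedEmbedding_smul_left (𝕜 := ℝ) he).isClosedMap _ (isClosed_Ici (a := (1 : ℝ)))
  convert h.isOpen_compl using 1
  ext x
  simp [rayCompl]

theorem dense_rayCompl {e : E} (hE : ¬ FiniteDimensional ℝ E) : Dense (rayCompl e) := by
  obtain ⟨v, hv⟩ : ∃ v, v ∉ Submodule.span ℝ {e} := by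
    by_contra! h
    apply hE
    have : Submodule.span ℝ {e} = ⊤ := by rw [eq_top_iff]; exact fun x _ => h x
    exact Module.finite_def.2 (this ▸ Submodule.fg_span_singleton e)
  intro x
  by_cases hx : x ∈ rayCompl e
  · exact subset_closure hx
  simp only [rayCompl, Set.mem_ofPred_eq, not_forall, not_not] at hx
  obtain ⟨t, ht, rfl⟩ := hx
  have hlim : Tendsto (fun n : ℕ => t • e + (1 / ((n : ℝ) + 1)) • v) atTop
      (𝓝 (t • e + (0 : ℝ) • v)) :=
    tendsto_const_nhds.add (tendsto_one_div_add_atTop_nhds_zero_nat.smul_const v)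
  rw [zero_smul, add_zero] at hlim
  refine mem_closure_of_tendsto hlim (Eventually.of_forall fun n s hs h => hv ?_)
  have hn : (1 / ((n : ℝ) + 1)) ≠ 0 := by positivity
  have : (1 / ((n : ℝ) + 1)) • v ∈ Submodule.span ℝ {e} := by
    rw [show (1 / ((n : ℝ) + 1)) • v = (s - t) • e by rw [sub_smul, h]; abel]
    exact Submodule.smul_mem _ _ (Submodule.mem_span_singleton_self e)
  exact (Submodule.smul_mem_iff _ hn).1 this

theorem contractibleSpace_rayCompl {e : E} (he : e ≠ 0) : ContractibleSpace (rayCompl e) := by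
  have hs : StarConvex ℝ 0 (rayCompl e) := by
    refine starConvex_zero_iff.2 fun x hx a ha0 ha1 t ht h => ?_
    rcases eq_or_lt_of_le ha0 with rfl | ha
    · rw [zero_smul] at h
      exact zero_mem_rayCompl he t ht h
    · refine hx (a⁻¹ * t) ?_ ?_
      · rw [inv_mul_eq_div, le_div_iff₀ ha]; linarith
      · rw [mul_smul, h, smul_smul, inv_mul_cancel₀ ha.ne', one_smul]
  exact hs.contractibleSpace ⟨0, zero_mem_rayCompl he⟩

theorem map_mem_rayCompl {e : E} (T : linearIsometriesFixing E e) {x : E} (hx : x ∈ rayCompl e) :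
    (T : E ≃ₗᵢ[ℝ] E) x ∈ rayCompl e := fun t ht h => hx t ht <| by
  have hT : (T : E ≃ₗᵢ[ℝ] E) e = e := T.2
  apply (T : E ≃ₗᵢ[ℝ] E).injective
  rw [map_smul, hT, h]

/-- The restriction of linear isometries to the complement of a ray. -/
def rayComplHom (e : E) : linearIsometriesFixing E e →* (rayCompl e ≃ᵢ rayCompl e) where
  toFun T := IsometryEquiv.mk' (fun x => ⟨(T : E ≃ₗᵢ[ℝ] E) x, map_mem_rayCompl T x.2⟩)
    (fun x => ⟨(T⁻¹ : linearIsometriesFixing E e).1 x, map_mem_rayCompl T⁻¹ x.2⟩)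
    (fun x => Subtype.ext ((T : E ≃ₗᵢ[ℝ] E).apply_symm_apply x))
    (Isometry.of_dist_eq fun x y => (T : E ≃ₗᵢ[ℝ] E).dist_map x y)
  map_one' := by ext; rfl
  map_mul' S T := by ext; rfl

theorem rayComplHom_apply {e : E} (T : linearIsometriesFixing E e) (x : rayCompl e) :
    (rayComplHom e T x : E) = (T : E ≃ₗᵢ[ℝ] E) x := rfl

theorem rayComplHom_injective {e : E} (he : e ≠ 0) : Function.Injective (rayComplHom e) :=
    fun S T h => by
  have h1 : ∀ x ∈ rayCompl e, (S : E ≃ₗᵢ[ℝ] E) x = (T : E ≃ₗᵢ[ℝ] E) x := fun x hx =>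
    congrArg (fun f : rayCompl e ≃ᵢ rayCompl e => (f ⟨x, hx⟩ : E)) h
  ext x
  rcases mem_or_neg_mem_rayCompl he x with hx | hx
  · exact h1 x hx
  · simpa using h1 _ hx

/-- A surjective isometry of a half-line is the identity. -/
theorem eq_self_of_isometry_Ici (h : ℝ → ℝ) (h1 : ∀ t, 1 ≤ t → 1 ≤ h t)
    (h2 : ∀ t s, 1 ≤ t → 1 ≤ s → |h t - h s| = |t - s|) (h3 : ∀ s, 1 ≤ s → ∃ t, 1 ≤ t ∧ h t = s)
    (t : ℝ) (ht : 1 ≤ t) : h t = t := by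
  obtain ⟨a, ha, haa⟩ := h3 1 le_rfl
  have hf : ∀ t, 1 ≤ t → h t = 1 + |t - a| := fun t ht => by
    have := h2 t a ht ha
    rw [haa, abs_of_nonneg (by linarith [h1 t ht])] at this
    linarith
  -- The points `1` and `2 * a - 1` are symmetric about the preimage `a` of the endpoint, so they
  -- have the same image and must coincide.
  have ha1 : a = 1 := by
    have h4 := h2 1 (2 * a - 1) le_rfl (by linarith)
    rw [hf 1 le_rfl, hf (2 * a - 1) (by linarith), abs_of_nonpos (by linarith : 1 - a ≤ 0),
      abs_of_nonneg (by linarith : 0 ≤ 2 * a - 1 - a),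
      abs_of_nonpos (by linarith : 1 - (2 * a - 1) ≤ 0)] at h4
    rw [show 1 + -(1 - a) - (1 + (2 * a - 1 - a)) = 0 by ring, abs_zero] at h4
    linarith
  rw [hf t ht, ha1, abs_of_nonneg (by linarith)]; ring

theorem rayComplHom_surjective {e : E} (he : e ≠ 0) (hE : ¬ FiniteDimensional ℝ E) :
    Function.Surjective (rayComplHom e) := by
  intro f
  obtain ⟨g, hg⟩ := exists_isometryEquiv_extending (dense_rayCompl hE) (zero_mem_rayCompl he)
    (mem_or_neg_mem_rayCompl he) f
  have hg1 : ∀ x, x ∈ rayCompl e → g x ∈ rayCompl e := fun x hx => by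
    rw [hg ⟨x, hx⟩]; exact (f ⟨x, hx⟩).2
  have hg2 : ∀ x, g x ∈ rayCompl e → x ∈ rayCompl e := fun x hx => by
    have : g (f.symm ⟨g x, hx⟩ : rayCompl e) = g x := by rw [hg, f.apply_symm_apply]
    rw [← g.injective this]; exact (f.symm ⟨g x, hx⟩).2
  have hray : ∀ t : ℝ, 1 ≤ t → ∃ s : ℝ, 1 ≤ s ∧ s • e = g (t • e) := fun t ht => by
    by_contra! h
    exact hg2 (t • e) h t ht rfl
  have hray' : ∀ t : ℝ, 1 ≤ t → ∃ s : ℝ, 1 ≤ s ∧ g (s • e) = t • e := fun t ht => by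
    by_contra! h
    have := hg1 (g.symm (t • e)) fun s hs h' => h s hs (by rw [h', g.apply_symm_apply])
    rw [g.apply_symm_apply] at this
    exact this t ht rfl
  choose! h hh1 hh2 using hray
  have hnorm : ∀ t s : ℝ, dist (t • e) (s • e) = |t - s| * ‖e‖ := fun t s => by
    rw [dist_eq_norm, ← sub_smul, norm_smul, Real.norm_eq_abs]
  have hen : ‖e‖ ≠ 0 := norm_ne_zero_iff.2 he
  have hid := eq_self_of_isometry_Ici h hh1 (fun t s ht hs => by
      have := g.dist_eq (t • e) (s • e)
      rw [← hh2 t ht, ← hh2 s hs, hnorm, hnorm] at this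
      exact mul_right_cancel₀ hen this) (fun s hs => by
      obtain ⟨t, ht, h'⟩ := hray' s hs
      refine ⟨t, ht, smul_left_injective ℝ he ?_⟩
      simp only [hh2 t ht, h'])
  have hfix : ∀ t : ℝ, 1 ≤ t → g (t • e) = t • e := fun t ht => by
    rw [← hh2 t ht, hid t ht]
  have hL := g.toRealLinearIsometryEquiv_apply
  have h1 : g e = e := by simpa using hfix 1 le_rfl
  -- The linear part is `x ↦ g x - g 0`; comparing its values at `e` and `2 e`, both fixed by `g`,
  -- yields `g 0 = 0`.
  have h0 : g 0 = 0 := by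
    have a1 := hL e
    have a2 := hL ((2 : ℝ) • e)
    rw [map_smul, a1, h1, hfix 2 (by norm_num), smul_sub] at a2
    rw [two_smul ℝ (g 0)] at a2
    have : (2 : ℝ) • e - g 0 - ((2 : ℝ) • e - (g 0 + g 0)) = g 0 := by abel
    rw [a2, sub_self] at this
    exact this.symm
  refine ⟨⟨g.toRealLinearIsometryEquiv, ?_⟩, ?_⟩
  · change g.toRealLinearIsometryEquiv e = e
    rw [hL, h0, h1, sub_zero]
  · ext x
    rw [rayComplHom_apply]
    change g.toRealLinearIsometryEquiv x = _
    rw [hL, h0, sub_zero, hg]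

/-- The isometries of the complement of a ray are the restrictions of linear isometries. -/
noncomputable def rayComplEquiv {e : E} (he : e ≠ 0) (hE : ¬ FiniteDimensional ℝ E) :
    linearIsometriesFixing E e ≃* (rayCompl e ≃ᵢ rayCompl e) :=
  MulEquiv.ofBijective (rayComplHom e) ⟨rayComplHom_injective he, rayComplHom_surjective he hE⟩

theorem rayComplEquiv_apply {e : E} (he : e ≠ 0) (hE : ¬ FiniteDimensional ℝ E)
    (T : linearIsometriesFixing E e) (x : rayCompl e) :
    (rayComplEquiv he hE T x : E) = (T : E ≃ₗᵢ[ℝ] E) x := rfl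

theorem rayComplEquiv_symm_apply {e : E} (he : e ≠ 0) (hE : ¬ FiniteDimensional ℝ E)
    (f : rayCompl e ≃ᵢ rayCompl e) (x : rayCompl e) :
    (((rayComplEquiv he hE).symm f : linearIsometriesFixing E e) : E ≃ₗᵢ[ℝ] E) x = f x := by
  rw [← rayComplEquiv_apply he hE, MulEquiv.apply_symm_apply]

/-- The isometries of the complement of a ray are the restrictions of linear isometries, as
topological groups. -/
noncomputable def rayComplContinuousMulEquiv {e : E} (he : e ≠ 0)
    (hE : ¬ FiniteDimensional ℝ E) :
    linearIsometriesFixing E e ≃ₜ* (rayCompl e ≃ᵢ rayCompl e) where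
  toMulEquiv := rayComplEquiv he hE
  continuous_toFun := by
    refine continuous_isometryEquiv_iff.2 fun x => ?_
    exact (continuous_linearIsometriesFixing_iff.1 continuous_id (x : E)).subtype_mk _
  continuous_invFun := by
    refine continuous_linearIsometriesFixing_iff.2 fun x => ?_
    have h : ∀ x : rayCompl e, Continuous fun f : rayCompl e ≃ᵢ rayCompl e =>
        (((rayComplEquiv he hE).symm f : linearIsometriesFixing E e) : E ≃ₗᵢ[ℝ] E) x := fun x =>
      (continuous_subtype_val.comp (continuous_isometryEquiv_iff.1 continuous_id x)).congr
        fun f => (rayComplEquiv_symm_apply he hE f x).symm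
    rcases mem_or_neg_mem_rayCompl he x with hx | hx
    · exact h ⟨x, hx⟩
    · refine (h ⟨-x, hx⟩).neg.congr fun f => ?_
      simp

end RayComplement

/-! ### Rigidification: encoding labels and a well-order in a metric -/

/-- A bounded pseudometric space together with a family of bounded Lipschitz functions. -/
class LabelledSpace (W P : Type u) [PseudoMetricSpace P] where
  dist_le : ∀ p q : P, dist p q ≤ 1 / 2
  label : W → P → ℝ
  label_nonneg : ∀ w p, 0 ≤ label w p
  label_le : ∀ w p, label w p ≤ 1 / 4
  label_lipschitz : ∀ w p q, |label w p - label w q| ≤ dist p q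

/-- A labelled space with additional points encoding the labels and an order of the set of
labels. -/
inductive Rigidification (W P : Type u) : Type u
  | pt (p : P)
  | lo (w : W)
  | hi (w : W)
  | top

namespace Rigidification

open LabelledSpace

variable {W P : Type u} [LinearOrder W] [PseudoMetricSpace P] [LabelledSpace W P]

/-- The distance on the rigidification of a labelled space. -/
noncomputable def rdist : Rigidification W P → Rigidification W P → ℝ
  | pt p, pt q => dist p q
  | pt p, lo w => 1 / 2 + label w p
  | pt _, hi _ => 1 / 2
  | pt _, top => 17 / 20
  | lo w, pt p => 1 / 2 + label w p
  | lo w, lo w' => if w = w' then 0 else 1 / 2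
  | lo w, hi w' => if w ≤ w' then 1 / 2 else 3 / 4
  | lo _, top => 9 / 10
  | hi _, pt _ => 1 / 2
  | hi w', lo w => if w ≤ w' then 1 / 2 else 3 / 4
  | hi w, hi w' => if w = w' then 0 else 1 / 2
  | hi _, top => 19 / 20
  | top, pt _ => 17 / 20
  | top, lo _ => 9 / 10
  | top, hi _ => 19 / 20
  | top, top => 0

/-- All distances are at most one, so two sides of length at least `1 / 2` suffice. A shorter side
joins two points `pt`, where the Lipschitz condition on labels is what is needed, or a point to
itself. -/
theorem rdist_triangle (x y z : Rigidification W P) : rdist x z ≤ rdist x y + rdist y z := by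
  have h0 : ∀ p q : P, 0 ≤ dist p q := fun _ _ => dist_nonneg
  have h1 : ∀ p q : P, dist p q ≤ 1 / 2 := dist_le W
  have h2 : ∀ (w : W) (p : P), 0 ≤ label w p := label_nonneg
  have h3 : ∀ (w : W) (p : P), label w p ≤ 1 / 4 := label_le
  have h4 : ∀ (w : W) (p q : P), label w p ≤ label w q + dist p q := fun w p q => by
    linarith [(abs_le.1 (label_lipschitz w p q)).2]
  have h5 : ∀ (w : W) (p q : P), label w p ≤ label w q + dist q p := fun w p q => by
    rw [dist_comm]; exact h4 w p q
  rcases x with p | a | a | _ <;> rcases y with q | b | b | _ <;> rcases z with r | d | d | _ <;>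
    simp only [rdist] <;>
    first
    | exact dist_triangle p q r
    | linarith [h0 p q, h1 p q, h2 d p, h2 d q, h3 d p, h3 d q, h4 d p q]
    | linarith [h0 q r, h1 q r, h2 a r, h2 a q, h3 a r, h3 a q, h5 a r q]
    | linarith [h1 p r, h2 b p, h2 b r]
    | linarith [h0 p q]
    | linarith [h0 q r]
    | linarith [h1 p r]
    | linarith [h2 b p, h2 d p, h3 b p, h3 d p]
    | linarith [h2 d p, h3 d p]
    | linarith [h2 b p, h3 b p]
    | linarith [h2 a q, h3 a q, h2 d q, h3 d q]
    | linarith [h2 a q, h3 a q]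
    | linarith [h2 d q, h3 d q]
    | linarith [h2 a r, h2 b r, h3 a r, h3 b r]
    | linarith [h2 a r, h3 a r]
    | linarith [h2 b r, h3 b r]
    | (split_ifs <;> first
        | (subst_vars; first | linarith | (exfalso; order) | (simp_all; done))
        | (subst_vars; linarith [h2 b p, h2 d p, h3 b p, h3 d p])
        | (subst_vars; linarith [h2 a r, h2 b r, h3 a r, h3 b r])
        | linarith [h2 b p, h2 d p, h3 b p, h3 d p]
        | linarith [h2 a r, h2 b r, h3 a r, h3 b r]
        | linarith [h2 a q, h3 a q, h2 d q, h3 d q])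
    | linarith

noncomputable instance : PseudoMetricSpace (Rigidification W P) where
  dist := rdist
  dist_self x := by rcases x with p | a | a | _ <;> simp [rdist]
  dist_comm x y := by
    rcases x with p | a | a | _ <;> rcases y with q | b | b | _ <;>
      simp [rdist, dist_comm, eq_comm]
  dist_triangle := rdist_triangle

theorem dist_def (x y : Rigidification W P) : dist x y = rdist x y := rfl

theorem dist_le_one (x y : Rigidification W P) : dist x y ≤ 1 := by
  have h1 : ∀ p q : P, dist p q ≤ 1 / 2 := dist_le W
  have h3 : ∀ (w : W) (p : P), label w p ≤ 1 / 4 := label_le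
  rcases x with p | a | a | _ <;> rcases y with q | b | b | _ <;> simp only [dist_def, rdist] <;>
    first
    | linarith [h1 p q]
    | linarith [h3 b p]
    | linarith [h3 a q]
    | (split_ifs <;> norm_num)
    | norm_num

/-- The metric space associated with a labelled space. -/
abbrev Space (W P : Type u) [LinearOrder W] [PseudoMetricSpace P] [LabelledSpace W P] : Type u :=
  SeparationQuotient (Rigidification W P)

theorem exists_rep (x : Space W P) : ∃ a : Rigidification W P, SeparationQuotient.mk a = x :=
  SeparationQuotient.surjective_mk x

local notation "π" => SeparationQuotient.mk

theorem dist_mk (x y : Rigidification W P) : dist (π x : Space W P) (π y) = rdist x y :=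
  SeparationQuotient.dist_mk x y

theorem mk_eq_mk_iff (x y : Rigidification W P) : (π x : Space W P) = π y ↔ rdist x y = 0 := by
  rw [← dist_eq_zero, dist_mk]

theorem mk_lo_injective : Function.Injective fun w : W => (π (lo w) : Space W P) := fun a b h => by
  by_contra hab
  rw [mk_eq_mk_iff] at h
  simp [rdist, hab] at h

theorem mk_hi_injective : Function.Injective fun w : W => (π (hi w) : Space W P) := fun a b h => by
  by_contra hab
  rw [mk_eq_mk_iff] at h
  simp [rdist, hab] at h

variable [Nonempty W]

/-- Only `top` has no point at positive distance less than `4 / 5`. -/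
theorem map_top (φ : Space W P ≃ᵢ Space W P) : φ (π top) = π top := by
  obtain ⟨a, ha⟩ := exists_rep (φ (π top))
  have far : ∀ b : Rigidification W P, rdist a b < 4 / 5 → rdist a b = 0 := by
    intro b hb
    obtain ⟨x, hx⟩ := exists_rep (φ.symm (π b))
    have e : rdist a b = rdist top x := by
      rw [← dist_mk, ← dist_mk, ha, hx, ← φ.dist_eq (π top), φ.apply_symm_apply]
    rw [e] at hb ⊢
    rcases x with p | w | w | _ <;> simp only [rdist] at hb ⊢ <;> norm_num at hb
  obtain ⟨w⟩ := ‹Nonempty W›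
  rw [← ha]
  rcases a with p | v | v | _
  · have h2 := label_le w p
    have h3 := label_nonneg w p
    have := far (lo w) (by simp only [rdist]; linarith)
    simp only [rdist] at this
    linarith
  · have := far (hi v) (by simp only [rdist, le_refl, if_true]; norm_num)
    simp [rdist] at this
  · have := far (lo v) (by simp only [rdist, le_refl, if_true]; norm_num)
    simp [rdist] at this
  · rfl

/-- The distance to `top` takes different values on `pt`, `lo` and `hi`, so isometries preserve the
three kinds of points. -/
theorem rdist_top_eq (φ : Space W P ≃ᵢ Space W P) {a b : Rigidification W P} (h : φ (π a) = π b) :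
    rdist b top = rdist a top := by
  rw [← dist_mk, ← dist_mk, ← h]
  conv_lhs => rw [← map_top φ]
  exact φ.dist_eq _ _

theorem exists_map_pt (φ : Space W P ≃ᵢ Space W P) (p : P) : ∃ q : P, φ (π (pt p)) = π (pt q) := by
  obtain ⟨b, hb⟩ := exists_rep (φ (π (pt p)))
  have := rdist_top_eq φ hb.symm
  rcases b with q | v | v | _ <;> simp only [rdist] at this <;> norm_num at this
  exact ⟨q, hb.symm⟩

theorem exists_map_lo (φ : Space W P ≃ᵢ Space W P) (w : W) : ∃ v : W, φ (π (lo w)) = π (lo v) := by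
  obtain ⟨b, hb⟩ := exists_rep (φ (π (lo w)))
  have := rdist_top_eq φ hb.symm
  rcases b with q | v | v | _ <;> simp only [rdist] at this <;> norm_num at this
  exact ⟨v, hb.symm⟩

theorem exists_map_hi (φ : Space W P ≃ᵢ Space W P) (w : W) : ∃ v : W, φ (π (hi w)) = π (hi v) := by
  obtain ⟨b, hb⟩ := exists_rep (φ (π (hi w)))
  have := rdist_top_eq φ hb.symm
  rcases b with q | v | v | _ <;> simp only [rdist] at this <;> norm_num at this
  exact ⟨v, hb.symm⟩

/-- The distance from `lo a` to `hi b` tells whether `a ≤ b`. If `s b ≤ s a`, then `s b ≤ t a`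
because `s a ≤ t a`, whence `b ≤ a`. -/
theorem exists_monotone_map_lo (φ : Space W P ≃ᵢ Space W P) : ∃ s t : W → W,
    (∀ w, φ (π (lo w)) = π (lo (s w))) ∧ (∀ w, φ (π (hi w)) = π (hi (t w))) ∧
      (∀ a b, a ≤ b ↔ s a ≤ t b) ∧ StrictMono s := by
  choose s hs using exists_map_lo φ
  choose t ht using exists_map_hi φ
  choose t' ht' using exists_map_hi φ.symm
  have htt : ∀ w, t (t' w) = w := fun w => by
    apply mk_hi_injective (P := P)
    simp only
    rw [← ht, ← ht', φ.apply_symm_apply]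
  have hle : ∀ a b, a ≤ b ↔ s a ≤ t b := fun a b => by
    have h := φ.dist_eq (π (lo a)) (π (hi b))
    rw [hs, ht, dist_mk, dist_mk] at h
    simp only [rdist] at h
    split_ifs at h with h1 h2 h2
    · exact ⟨fun _ => h1, fun _ => h2⟩
    · norm_num at h
    · norm_num at h
    · exact ⟨fun h => absurd h h2, fun h => absurd h h1⟩
  refine ⟨s, t, hs, ht, hle, fun a b hab => ?_⟩
  by_contra h
  push Not at h
  have : b ≤ a := by
    have := (hle a a).1 le_rfl
    rw [hle]; exact h.trans this
  exact absurd hab (not_lt.2 this)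

variable [WellFoundedLT W]

/-- A strictly monotone self-map of a well-order lies above the identity; this applies to `φ` and to
its inverse. -/
theorem map_lo (φ : Space W P ≃ᵢ Space W P) (w : W) : φ (π (lo w)) = π (lo w) := by
  obtain ⟨s, t, hs, ht, hle, hmono⟩ := exists_monotone_map_lo φ
  obtain ⟨s', t', hs', -, -, hmono'⟩ := exists_monotone_map_lo φ.symm
  have h1 : s' (s w) = w := by
    apply mk_lo_injective (P := P)
    simp only
    rw [← hs', ← hs, φ.symm_apply_apply]
  have h2 : s w = w := le_antisymm ((hmono'.le_apply).trans h1.le) hmono.le_apply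
  rw [hs, h2]

theorem map_hi (φ : Space W P ≃ᵢ Space W P) (w : W) : φ (π (hi w)) = π (hi w) := by
  obtain ⟨s, t, hs, ht, hle, -⟩ := exists_monotone_map_lo φ
  have h1 : ∀ v, s v = v := fun v => by
    apply mk_lo_injective (P := P)
    simp only
    rw [← hs, map_lo]
  simp only [h1] at hle
  have h2 : t w = w := le_antisymm ((hle (t w) w).2 le_rfl) ((hle w w).1 le_rfl)
  rw [ht, h2]

theorem label_eq (φ : Space W P ≃ᵢ Space W P) {p q : P} (h : φ (π (pt p)) = π (pt q)) (w : W) :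
    label w q = label w p := by
  have h1 := φ.dist_eq (π (pt p)) (π (lo w))
  rw [h, map_lo, dist_mk, dist_mk] at h1
  simpa [rdist] using h1

end Rigidification

/-! ### The space of pairs of a group element and a sequence -/

/-- A family of left-invariant pseudometrics defining the topology of `G`, which contains the zero
pseudometric, together with a family of indices and points which is dense in every term. -/
structure InvariantFamily (G W : Type u) [Group G] [TopologicalSpace G] where
  ι : Type u
  ρ : ι → LeftPseudometric G
  base : ι
  base_eq : ρ base = 0
  exists_ball : ∀ V ∈ 𝓝 (1 : G), ∃ i, ∃ ε > 0, ∀ g, ρ i 1 g < ε → g ∈ V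
  code : W → ι × G × ℕ
  code_dense : ∀ i a n, ∀ ε > 0, ∃ w b, code w = (i, b, n) ∧ ρ i a b < ε

namespace InvariantFamily

variable {G W : Type u} [Group G] [TopologicalSpace G] (D : InvariantFamily G W)

/-- The disjoint union of copies of `G`, one for each pseudometric of the family. -/
abbrev Point : Type u := D.ι × G

variable {D}

/-- The translation on the disjoint union of copies of `G`. -/
def act (k : G) (x : D.Point) : D.Point := (x.1, k * x.2)

theorem act_act (k l : G) (x : D.Point) : act k (act l x) = act (k * l) x := by
  simp [act, mul_assoc]

@[simp] theorem act_one (x : D.Point) : act 1 x = x := by simp [act]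

open Classical in
/-- The pseudometric on the disjoint union of copies of `G`. -/
noncomputable def pdist (x y : D.Point) : ℝ := if x.1 = y.1 then D.ρ x.1 x.2 y.2 else 1

theorem pdist_mk (i : D.ι) (a b : G) : pdist (D := D) (i, a) (i, b) = D.ρ i a b := by simp [pdist]

@[simp] theorem pdist_self (x : D.Point) : pdist x x = 0 := by
  simp [pdist, (D.ρ _).self']

theorem pdist_comm (x y : D.Point) : pdist x y = pdist y x := by
  obtain ⟨i, a⟩ := x
  obtain ⟨j, b⟩ := y
  by_cases h : i = j
  · subst h; simp [pdist, (D.ρ _).symm' a]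
  · simp [pdist, h, Ne.symm h]

theorem pdist_nonneg (x y : D.Point) : 0 ≤ pdist x y := by
  unfold pdist; split_ifs
  · exact (D.ρ _).nonneg' _ _
  · exact zero_le_one

theorem pdist_le_one (x y : D.Point) : pdist x y ≤ 1 := by
  unfold pdist; split_ifs
  · exact (D.ρ _).le_one' _ _
  · exact le_rfl

theorem pdist_triangle (x y z : D.Point) : pdist x z ≤ pdist x y + pdist y z := by
  obtain ⟨i, a⟩ := x
  obtain ⟨j, b⟩ := y
  obtain ⟨k, c⟩ := z
  by_cases h1 : i = j
  · subst h1
    by_cases h2 : i = k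
    · subst h2
      simpa [pdist] using (D.ρ i).triangle' a b c
    · simp [pdist, h2, (D.ρ _).nonneg']
  · have := pdist_le_one (D := D) (i, a) (k, c)
    have h3 : pdist (D := D) (i, a) (j, b) = 1 := by simp [pdist, h1]
    have := pdist_nonneg (D := D) (j, b) (k, c)
    linarith

@[simp] theorem pdist_act (k : G) (x y : D.Point) : pdist (act k x) (act k y) = pdist x y := by
  unfold pdist act
  simp only [(D.ρ _).mul_left']

/-- The copy of `G` with the zero pseudometric provides a neutral padding point: distances to it do
not see group elements, so padded terms cancel when two distances are compared. -/
theorem pdist_base_act (x : D.Point) (g h k l : G) :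
    pdist (act g x) (act h (D.base, 1)) = pdist (act k x) (act l (D.base, 1)) := by
  obtain ⟨i, c⟩ := x
  by_cases h : i = D.base
  · subst h; simp [pdist, act, D.base_eq]
  · simp [pdist, act, h]

theorem pdist_eq_zero_trans {x y z : D.Point} (h : pdist x y = 0) (h' : pdist y z = 0) :
    pdist x z = 0 :=
  le_antisymm ((pdist_triangle x y z).trans_eq (by rw [h, h', add_zero])) (pdist_nonneg _ _)

theorem pdist_eq_zero_symm {x y : D.Point} (h : pdist x y = 0) : pdist y x = 0 := by
  rwa [pdist_comm]

variable (D) in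
/-- Pairs of an element of `G` and a sequence of points, thought of as a translate of the sequence
together with the sequence. -/
@[ext]
structure Orbit : Type u where
  elt : G
  seq : ℕ → D.Point

/-- The summands in the definition of the distance. -/
noncomputable def orbitTerm (p q : D.Orbit) (n : ℕ) : ℝ :=
  (1 / 2) ^ (n + 3) * (pdist (act p.1 (p.2 n)) (act q.1 (q.2 n)) + pdist (p.2 n) (q.2 n))

theorem orbitTerm_nonneg (p q : D.Orbit) (n : ℕ) : 0 ≤ orbitTerm p q n :=
  mul_nonneg (by positivity) (add_nonneg (pdist_nonneg _ _) (pdist_nonneg _ _))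

/-- The exponent `n + 3` makes the sum at most `1 / 2`, the diameter allowed in a labelled space. -/
theorem orbitTerm_le (p q : D.Orbit) (n : ℕ) : orbitTerm p q n ≤ 1 / 4 * (1 / 2) ^ n := by
  have h1 := pdist_le_one (act p.1 (p.2 n)) (act q.1 (q.2 n))
  have h2 := pdist_le_one (p.2 n) (q.2 n)
  have h3 : (0 : ℝ) ≤ (1 / 2) ^ n := by positivity
  unfold orbitTerm
  rw [pow_add]
  nlinarith

theorem summable_orbitTerm (p q : D.Orbit) : Summable (orbitTerm p q) :=
  Summable.of_nonneg_of_le (orbitTerm_nonneg p q) (orbitTerm_le p q)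
    (summable_geometric_two.mul_left _)

noncomputable instance : PseudoMetricSpace D.Orbit where
  dist p q := ∑' n, orbitTerm p q n
  dist_self p := by simp [orbitTerm]
  dist_comm p q := by
    refine tsum_congr fun n => ?_
    simp only [orbitTerm, pdist_comm (act p.1 _), pdist_comm (p.2 n)]
  dist_triangle p q r := by
    rw [← (summable_orbitTerm p q).tsum_add (summable_orbitTerm q r)]
    refine (summable_orbitTerm p r).tsum_le_tsum (fun n => ?_)
      ((summable_orbitTerm p q).add (summable_orbitTerm q r))
    unfold orbitTerm
    rw [← mul_add]
    refine mul_le_mul_of_nonneg_left ?_ (by positivity)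
    linarith [pdist_triangle (act p.1 (p.2 n)) (act q.1 (q.2 n)) (act r.1 (r.2 n)),
      pdist_triangle (p.2 n) (q.2 n) (r.2 n)]

theorem orbit_dist_def (p q : D.Orbit) : dist p q = ∑' n, orbitTerm p q n := rfl

theorem orbitTerm_le_dist (p q : D.Orbit) (n : ℕ) : orbitTerm p q n ≤ dist p q :=
  (summable_orbitTerm p q).le_tsum n fun j _ => orbitTerm_nonneg p q j

theorem orbit_dist_eq_zero_iff (p q : D.Orbit) : dist p q = 0 ↔
    ∀ n, pdist (act p.1 (p.2 n)) (act q.1 (q.2 n)) = 0 ∧ pdist (p.2 n) (q.2 n) = 0 := by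
  constructor
  · intro h n
    have h1 : orbitTerm p q n = 0 :=
      le_antisymm ((orbitTerm_le_dist p q n).trans h.le) (orbitTerm_nonneg p q n)
    have h2 : ((1 / 2 : ℝ)) ^ (n + 3) ≠ 0 := by positivity
    have h3 := (mul_eq_zero.1 h1).resolve_left h2
    have h4 := pdist_nonneg (act p.1 (p.2 n)) (act q.1 (q.2 n))
    have h5 := pdist_nonneg (p.2 n) (q.2 n)
    constructor <;> linarith
  · intro h
    rw [orbit_dist_def]
    simp [orbitTerm, h]

theorem orbit_dist_le (p q : D.Orbit) : dist p q ≤ 1 / 2 := by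
  have h := (summable_orbitTerm p q).tsum_le_tsum (orbitTerm_le p q)
    (summable_geometric_two.mul_left _)
  rw [tsum_mul_left, tsum_geometric_two] at h
  rw [orbit_dist_def]; linarith

noncomputable instance : LabelledSpace W D.Orbit where
  dist_le := orbit_dist_le
  label w p := (1 / 2) ^ ((D.code w).2.2 + 3) *
    pdist (p.2 (D.code w).2.2) ((D.code w).1, (D.code w).2.1)
  label_nonneg w p := mul_nonneg (by positivity) (pdist_nonneg _ _)
  label_le w p := by
    have h1 : ((1 / 2 : ℝ)) ^ ((D.code w).2.2) ≤ 1 := pow_le_one₀ (by norm_num) (by norm_num)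
    have h0 : 0 ≤ ((1 / 2 : ℝ)) ^ ((D.code w).2.2) := by positivity
    have h2 := pdist_le_one (p.2 (D.code w).2.2) ((D.code w).1, (D.code w).2.1)
    rw [pow_add]
    nlinarith
  label_lipschitz w p q := by
    refine le_trans ?_ (orbitTerm_le_dist p q (D.code w).2.2)
    rw [← mul_sub, abs_mul,
      abs_of_nonneg (by positivity : 0 ≤ ((1 / 2 : ℝ)) ^ ((D.code w).2.2 + 3))]
    refine mul_le_mul_of_nonneg_left ?_ (by positivity)
    have h1 := pdist_triangle (p.2 (D.code w).2.2) (q.2 (D.code w).2.2)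
      ((D.code w).1, (D.code w).2.1)
    have h2 := pdist_triangle (q.2 (D.code w).2.2) (p.2 (D.code w).2.2)
      ((D.code w).1, (D.code w).2.1)
    rw [pdist_comm (q.2 _) (p.2 _)] at h2
    have h3 := pdist_nonneg (act p.1 (p.2 (D.code w).2.2)) (act q.1 (q.2 (D.code w).2.2))
    rw [abs_le]
    constructor <;> linarith

theorem label_def (w : W) (p : D.Orbit) : LabelledSpace.label w p =
    (1 / 2) ^ ((D.code w).2.2 + 3) *
      pdist (p.2 (D.code w).2.2) ((D.code w).1, (D.code w).2.1) := rfl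

theorem exists_code_near (x : D.Point) (n : ℕ) {ε : ℝ} (hε : 0 < ε) :
    ∃ w, (D.code w).2.2 = n ∧ pdist x ((D.code w).1, (D.code w).2.1) < ε := by
  obtain ⟨w, b, hw, hb⟩ := D.code_dense x.1 x.2 n ε hε
  refine ⟨w, by rw [hw], ?_⟩
  rw [hw]
  exact (pdist_mk x.1 x.2 b).trans_lt hb

/-- Labels are rescaled distances from the `n`th term to a dense set of points, so they determine
that term up to distance zero. -/
theorem pdist_eq_zero_of_label_eq {p q : D.Orbit}
    (h : ∀ w : W, LabelledSpace.label w q = LabelledSpace.label w p) (n : ℕ) :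
    pdist (p.2 n) (q.2 n) = 0 := by
  refine le_antisymm (le_of_forall_pos_le_add fun ε hε => ?_) (pdist_nonneg _ _)
  obtain ⟨w, rfl, hw⟩ := exists_code_near (p.2 n) n (half_pos hε)
  have h1 := h w
  rw [label_def, label_def] at h1
  have h2 := mul_left_cancel₀ (by positivity) h1
  have h3 := pdist_triangle (p.2 (D.code w).2.2) ((D.code w).1, (D.code w).2.1)
    (q.2 (D.code w).2.2)
  rw [pdist_comm ((D.code w).1, (D.code w).2.1) (q.2 (D.code w).2.2), h2] at h3
  linarith

/-- The sequence with a single nontrivial term. -/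
def single (n : ℕ) (x : D.Point) : ℕ → D.Point := fun k => if k = n then x else (D.base, 1)

@[simp] theorem single_self (n : ℕ) (x : D.Point) : single n x n = x := by simp [single]

theorem single_of_ne {n k : ℕ} (h : k ≠ n) (x : D.Point) : single n x k = (D.base, 1) := by
  simp [single, h]

/-- The interleaving of two sequences. -/
def merge (y z : ℕ → D.Point) : ℕ → D.Point :=
  fun n => Sum.elim y z (Equiv.natSumNatEquivNat.symm n)

theorem exists_merge_left (y z : ℕ → D.Point) (n : ℕ) : ∃ k, merge y z k = y n :=
  ⟨Equiv.natSumNatEquivNat (Sum.inl n), by simp [merge]⟩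

theorem exists_merge_right (y z : ℕ → D.Point) (n : ℕ) : ∃ k, merge y z k = z n :=
  ⟨Equiv.natSumNatEquivNat (Sum.inr n), by simp [merge]⟩

/-- A `G_δ`-set uses countably many neighbourhoods, hence countably many pseudometrics. This is why
orbits carry sequences of points. -/
theorem exists_zero_subset_of_isGδ {s : Set G} (hs : IsGδ s) (h1 : (1 : G) ∈ s) :
    ∃ i : ℕ → D.ι, ∀ g, (∀ n, D.ρ (i n) 1 g = 0) → g ∈ s := by
  obtain ⟨f, hf, rfl⟩ := isGδ_iff_eq_iInter_nat.1 hs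
  rw [Set.mem_iInter] at h1
  have : ∀ n, ∃ i, ∃ ε > 0, ∀ g, D.ρ i 1 g < ε → g ∈ f n := fun n =>
    D.exists_ball _ ((hf n).mem_nhds (h1 n))
  choose i ε hε h using this
  exact ⟨i, fun g hg => Set.mem_iInter.2 fun n => h n g (by rw [hg n]; exact hε n)⟩

theorem isGδ_pdist_eq_zero [IsTopologicalGroup G] (x : D.Point) (g : G) :
    IsGδ {k : G | pdist (act k x) (act g x) = 0} := by
  have hc : Continuous fun k : G => pdist (act k x) (act g x) := by
    have : (fun k : G => pdist (act k x) (act g x)) =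
        fun k => D.ρ x.1 (g * x.2) (k * x.2) := by
      ext k
      rw [pdist_comm]
      exact pdist_mk _ _ _
    rw [this]
    exact ((D.ρ x.1).continuous_right _).comp (continuous_mul_const x.2)
  have : {k : G | pdist (act k x) (act g x) = 0} =
      ⋂ n : ℕ, {k : G | pdist (act k x) (act g x) < 1 / ((n : ℝ) + 1)} := by
    ext k
    simp only [Set.mem_ofPred_eq, Set.mem_iInter]
    constructor
    · intro h n; rw [h]; positivity
    · intro h
      refine le_antisymm (le_of_forall_pos_le_add fun ε hε => ?_) (pdist_nonneg _ _)
      obtain ⟨n, hn⟩ := exists_nat_one_div_lt hε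
      linarith [h n]
  rw [this]
  exact IsGδ.iInter_of_isOpen fun n => isOpen_lt hc continuous_const

end InvariantFamily

/-! ### Every isometry of the model is a translation -/

namespace InvariantFamily

open Rigidification

variable {G W : Type u} [Group G] [TopologicalSpace G] {D : InvariantFamily G W}

theorem orbit_dist_eq_zero_of_seq_eq {g h : G} {y z : ℕ → D.Point}
    (H : ∀ n, pdist (y n) (z n) = 0) (H' : ∀ n, pdist (act g (y n)) (act h (y n)) = 0) :
    dist (⟨g, y⟩ : D.Orbit) ⟨h, z⟩ = 0 := by
  refine (orbit_dist_eq_zero_iff _ _).2 fun n => ⟨?_, H n⟩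
  exact pdist_eq_zero_trans (H' n) (by rw [pdist_act]; exact H n)

/-- Equality of distances between translates of two sequences which agree in one term, while one
of the two sequences is trivial elsewhere. -/
theorem pdist_eq_of_dist_single_eq {g h k l : G} {y : ℕ → D.Point} {n : ℕ}
    (H : dist (⟨g, y⟩ : D.Orbit) ⟨h, single n (y n)⟩ =
      dist (⟨k, y⟩ : D.Orbit) ⟨l, single n (y n)⟩) :
    pdist (act g (y n)) (act h (y n)) = pdist (act k (y n)) (act l (y n)) := by
  set p : D.Orbit := ⟨g, y⟩
  set q : D.Orbit := ⟨h, single n (y n)⟩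
  set p' : D.Orbit := ⟨k, y⟩
  set q' : D.Orbit := ⟨l, single n (y n)⟩
  have h1 : ∑' m, (orbitTerm p q m - orbitTerm p' q' m) = 0 := by
    rw [(summable_orbitTerm p q).tsum_sub (summable_orbitTerm p' q'), sub_eq_zero]; exact H
  rw [tsum_eq_single n] at h1
  · have h2 : ((1 / 2 : ℝ)) ^ (n + 3) ≠ 0 := by positivity
    unfold orbitTerm at h1
    rw [← mul_sub] at h1
    have h3 := (mul_eq_zero.1 h1).resolve_left h2
    simp only [p, q, p', q', single_self] at h3
    linarith
  · intro m hm
    simp only [orbitTerm, p, q, p', q', single_of_ne hm]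
    rw [pdist_base_act (y m) g h k l, sub_self]

/-- The two distances differ only by the first summands, which vanish for `p`, `q` and are
nonnegative for `p'`, `q'`. -/
theorem pdist_eq_zero_of_dist_eq {p q p' q' : D.Orbit} (hp : p'.seq = p.seq) (hq : q'.seq = q.seq)
    (H : dist p' q' = dist p q) (h0 : ∀ n, pdist (act p.elt (p.seq n)) (act q.elt (q.seq n)) = 0)
    (n : ℕ) : pdist (act p'.elt (p.seq n)) (act q'.elt (q.seq n)) = 0 := by
  have h1 : HasSum (fun m => orbitTerm p' q' m - orbitTerm p q m) 0 := by
    have := (summable_orbitTerm p' q').hasSum.sub (summable_orbitTerm p q).hasSum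
    rwa [show ∑' m, orbitTerm p' q' m - ∑' m, orbitTerm p q m = 0 from sub_eq_zero.2 H] at this
  have h2 : ∀ m, orbitTerm p' q' m - orbitTerm p q m =
      (1 / 2) ^ (m + 3) * pdist (act p'.elt (p.seq m)) (act q'.elt (q.seq m)) := fun m => by
    simp only [orbitTerm, hp, hq, h0]; ring
  have h3 := (hasSum_zero_iff_of_nonneg (fun m => by
    rw [h2]; exact mul_nonneg (by positivity) (pdist_nonneg _ _))).1 h1
  have h4 := congrFun h3 n
  rw [h2, Pi.zero_apply] at h4
  exact (mul_eq_zero.1 h4).resolve_left (by positivity)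

theorem tendsto_gDelta_nhds_one {α : Type u} {F : Filter α} {f : α → G}
    (h : ∀ i : ℕ → D.ι, ∀ᶠ a in F, ∀ n, D.ρ (i n) 1 (f a) = 0) :
    Tendsto f F (@nhds G (gDeltaTopology G) 1) := by
  rw [TopologicalSpace.nhds_generateFrom]
  refine tendsto_iInf.2 fun s => tendsto_iInf.2 fun hs => tendsto_principal.2 ?_
  obtain ⟨i, hi⟩ := exists_zero_subset_of_isGδ (D := D) hs.2 hs.1
  filter_upwards [h i] with a ha using hi _ ha

variable [LinearOrder W]

variable (D) in
/-- The metric space constructed from an invariant family of pseudometrics. -/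
abbrev Model : Type u := Space W D.Orbit

/-- The class of an element of an orbit in the model. -/
noncomputable def toModel (p : D.Orbit) : D.Model := SeparationQuotient.mk (pt p)

theorem dist_toModel (p q : D.Orbit) : dist (toModel p) (toModel q) = dist p q :=
  dist_mk (pt p) (pt q)

theorem toModel_eq_iff {p q : D.Orbit} : toModel p = toModel q ↔ dist p q = 0 := by
  rw [← dist_eq_zero, dist_toModel]

variable [Nonempty W] [WellFoundedLT W]

theorem exists_map_toModel (φ : D.Model ≃ᵢ D.Model) (p : D.Orbit) :
    ∃ k : G, φ (toModel p) = toModel ⟨k, p.seq⟩ := by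
  obtain ⟨q, hq⟩ := exists_map_pt φ p
  refine ⟨q.elt, hq.trans (toModel_eq_iff.2 ?_)⟩
  refine orbit_dist_eq_zero_of_seq_eq (fun n => ?_) fun n => pdist_self _
  exact pdist_eq_zero_symm (pdist_eq_zero_of_label_eq (label_eq φ hq) n)

/-- The element of `G` by which an isometry of the model moves a given point. -/
noncomputable def shift (φ : D.Model ≃ᵢ D.Model) (p : D.Orbit) : G :=
  (exists_map_toModel φ p).choose

theorem map_toModel (φ : D.Model ≃ᵢ D.Model) (p : D.Orbit) :
    φ (toModel p) = toModel ⟨shift φ p, p.seq⟩ := (exists_map_toModel φ p).choose_spec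

theorem dist_shift (φ : D.Model ≃ᵢ D.Model) (p q : D.Orbit) :
    dist (⟨shift φ p, p.seq⟩ : D.Orbit) ⟨shift φ q, q.seq⟩ = dist p q := by
  rw [← dist_toModel, ← dist_toModel p q, ← φ.dist_eq (toModel p), map_toModel, map_toModel]

/-- The map on points induced by an isometry of the model. -/
noncomputable def pointMap (φ : D.Model ≃ᵢ D.Model) (x : D.Point) : D.Point :=
  act (shift φ ⟨1, single 0 x⟩) x

theorem pdist_shift_single (φ : D.Model ≃ᵢ D.Model) (y : ℕ → D.Point) (n : ℕ) :
    pdist (act (shift φ ⟨1, y⟩) (y n)) (act (shift φ ⟨1, single n (y n)⟩) (y n)) = 0 := by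
  rw [pdist_eq_of_dist_single_eq (dist_shift φ ⟨1, y⟩ ⟨1, single n (y n)⟩), pdist_self]

/-- The constant sequence with value `y n` links the positions `n` and `0`. -/
theorem pdist_shift_pointMap_one (φ : D.Model ≃ᵢ D.Model) (y : ℕ → D.Point) (n : ℕ) :
    pdist (act (shift φ ⟨1, y⟩) (y n)) (pointMap φ (y n)) = 0 := by
  refine pdist_eq_zero_trans (pdist_shift_single φ y n) ?_
  have h1 := pdist_shift_single φ (fun _ => y n) n
  have h2 := pdist_shift_single φ (fun _ => y n) 0
  exact pdist_eq_zero_trans (pdist_eq_zero_symm h1) h2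

/-- The element `p` is compared with `q`, which has neutral group element and the translated
sequence of `p` as its sequence: their translated sequences coincide, and isometries preserve this
coincidence. -/
theorem pdist_shift_pointMap (φ : D.Model ≃ᵢ D.Model) (p : D.Orbit) (n : ℕ) :
    pdist (act (shift φ p) (p.seq n)) (pointMap φ (act p.elt (p.seq n))) = 0 := by
  let q : D.Orbit := ⟨1, fun n => act p.elt (p.seq n)⟩
  have h := pdist_eq_zero_of_dist_eq (p := p) (q := q)
    (p' := ⟨shift φ p, p.seq⟩) (q' := ⟨shift φ q, q.seq⟩) rfl rfl (dist_shift φ p q)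
    (fun n => by simp [q]) n
  exact pdist_eq_zero_trans h (pdist_shift_pointMap_one φ q.seq n)

/-- The inverse isometry supplies `h`. This surjectivity yields the half of the Cauchy condition
that concerns `k * l⁻¹`. -/
theorem exists_pointMap_eq (φ : D.Model ≃ᵢ D.Model) (i : D.ι) :
    ∃ h : G, pdist (pointMap φ (i, h)) (i, 1) = 0 := by
  set p : D.Orbit := ⟨1, single 0 (i, 1)⟩
  have h1 := map_toModel φ.symm p
  set h := shift φ.symm p
  have h2 := map_toModel φ ⟨h, p.seq⟩
  rw [← h1, φ.apply_symm_apply, toModel_eq_iff, orbit_dist_eq_zero_iff] at h2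
  have h3 := (h2 0).1
  have h4 := pdist_shift_pointMap φ ⟨h, p.seq⟩ 0
  simp only [p, single_self, act_one] at h3 h4
  refine ⟨h, pdist_eq_zero_symm (pdist_eq_zero_trans h3 ?_)⟩
  convert h4 using 2
  simp [act]

/-- Elements of `G` which move all terms of a sequence in the same way as an isometry. -/
def agree (φ : D.Model ≃ᵢ D.Model) (y : ℕ → D.Point) : Set G :=
  {k | ∀ n, pdist (act k (y n)) (pointMap φ (y n)) = 0}

theorem agree_nonempty (φ : D.Model ≃ᵢ D.Model) (y : ℕ → D.Point) : (agree φ y).Nonempty :=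
  ⟨_, pdist_shift_pointMap_one φ y⟩

theorem agree_merge (φ : D.Model ≃ᵢ D.Model) (y z : ℕ → D.Point) :
    agree φ (merge y z) ⊆ agree φ y ∩ agree φ z := fun k hk => by
  refine ⟨fun n => ?_, fun n => ?_⟩
  · obtain ⟨m, hm⟩ := exists_merge_left y z n
    rw [← hm]; exact hk m
  · obtain ⟨m, hm⟩ := exists_merge_right y z n
    rw [← hm]; exact hk m

/-- The filter of sets of elements which agree with an isometry on a sequence. -/
def agreeFilter (φ : D.Model ≃ᵢ D.Model) : Filter G := ⨅ y : ℕ → D.Point, 𝓟 (agree φ y)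

theorem directed_agree (φ : D.Model ≃ᵢ D.Model) :
    Directed (· ≥ ·) fun y : ℕ → D.Point => 𝓟 (agree φ y) := fun y z =>
  ⟨merge y z, principal_mono.2 fun _ hk => (agree_merge φ y z hk).1,
    principal_mono.2 fun _ hk => (agree_merge φ y z hk).2⟩

instance : Nonempty (ℕ → D.Point) := ⟨fun _ => (D.base, 1)⟩

theorem agreeFilter_neBot (φ : D.Model ≃ᵢ D.Model) : (agreeFilter φ).NeBot :=
  iInf_neBot_of_directed' (directed_agree φ) fun y =>
    principal_neBot_iff.2 (agree_nonempty φ y)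

theorem mem_agreeFilter {φ : D.Model ≃ᵢ D.Model} {s : Set G} :
    s ∈ agreeFilter φ ↔ ∃ y, agree φ y ⊆ s := by
  rw [agreeFilter, mem_iInf_of_directed (directed_agree φ)]
  simp

theorem agree_mem_agreeFilter (φ : D.Model ≃ᵢ D.Model) (y : ℕ → D.Point) :
    agree φ y ∈ agreeFilter φ := mem_agreeFilter.2 ⟨y, Set.Subset.rfl⟩

/-- Agreement at `(i, 1)` gives `ρ i k l = 0`. Agreement at a point `(i, h)` sent to `(i, 1)` puts
both `k⁻¹` and `l⁻¹` at distance zero from `h`. -/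
theorem exists_agree_cauchy (φ : D.Model ≃ᵢ D.Model) (i : ℕ → D.ι) :
    ∃ y, ∀ k ∈ agree φ y, ∀ l ∈ agree φ y,
      ∀ n, D.ρ (i n) 1 (k * l⁻¹) = 0 ∧ D.ρ (i n) 1 (k⁻¹ * l) = 0 := by
  choose h hh using fun n => exists_pointMap_eq φ (i n)
  refine ⟨merge (fun n => (i n, 1)) (fun n => (i n, h n)), fun k hk l hl n => ?_⟩
  have hk' := agree_merge _ _ _ hk
  have hl' := agree_merge _ _ _ hl
  constructor
  · have h1 := pdist_eq_zero_trans (hk'.2 n) (hh n)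
    have h2 := pdist_eq_zero_trans (hl'.2 n) (hh n)
    simp only [act, pdist_mk] at h1 h2
    rw [(D.ρ (i n)).symm', ← (D.ρ (i n)).inv_mul_one, (D.ρ (i n)).symm'] at h1 h2
    rw [← (D.ρ (i n)).inv_mul_one]
    refine le_antisymm (((D.ρ (i n)).triangle' _ (h n) _).trans ?_) ((D.ρ (i n)).nonneg' _ _)
    rw [(D.ρ (i n)).symm', h1, h2, add_zero]
  · have h1 := pdist_eq_zero_trans (hk'.1 n) (pdist_eq_zero_symm (hl'.1 n))
    simp only [act, pdist_mk, mul_one] at h1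
    rw [(D.ρ (i n)).one_inv_mul, h1]

theorem exists_translation [IsTopologicalGroup G] (hG : IsGDeltaComplete G)
    (φ : D.Model ≃ᵢ D.Model) : ∃ g : G, ∀ x : D.Point, pdist (pointMap φ x) (act g x) = 0 := by
  obtain ⟨g, hg⟩ := hG (agreeFilter φ) (agreeFilter_neBot φ)
    (tendsto_gDelta_nhds_one (D := D) fun i => by
      obtain ⟨y, hy⟩ := exists_agree_cauchy φ i
      filter_upwards [prod_mem_prod (agree_mem_agreeFilter φ y) (agree_mem_agreeFilter φ y)]
        with p hp n using (hy _ hp.1 _ hp.2 n).1)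
    (tendsto_gDelta_nhds_one (D := D) fun i => by
      obtain ⟨y, hy⟩ := exists_agree_cauchy φ i
      filter_upwards [prod_mem_prod (agree_mem_agreeFilter φ y) (agree_mem_agreeFilter φ y)]
        with p hp n using (hy _ hp.1 _ hp.2 n).2)
  refine ⟨g, fun x => ?_⟩
  -- This `τ_δ`-neighbourhood of the limit contains some `agree φ y`; an element agreeing also at
  -- `x` then compares `pointMap φ x` with the translate by `g`.
  have hopen : {k : G | pdist (act k x) (act g x) = 0} ∈ @nhds G (gDeltaTopology G) g :=
    @IsOpen.mem_nhds G (gDeltaTopology G) g _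
      (TopologicalSpace.isOpen_generateFrom_of_mem (isGδ_pdist_eq_zero x g)) (pdist_self _)
  obtain ⟨y, hy⟩ := mem_agreeFilter.1 (hg hopen)
  obtain ⟨k, hk⟩ := agree_nonempty φ (merge y fun _ => x)
  have hk' := agree_merge _ _ _ hk
  exact pdist_eq_zero_trans (pdist_eq_zero_symm (hk'.2 0)) (hy hk'.1)

theorem exists_map_toModel_eq [IsTopologicalGroup G] (hG : IsGDeltaComplete G)
    (φ : D.Model ≃ᵢ D.Model) : ∃ g : G, ∀ p : D.Orbit,
      φ (toModel p) = toModel ⟨g * p.elt, p.seq⟩ := by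
  obtain ⟨g, hg⟩ := exists_translation hG φ
  refine ⟨g, fun p => ?_⟩
  rw [map_toModel, toModel_eq_iff]
  refine orbit_dist_eq_zero_of_seq_eq (fun n => pdist_self _) fun n => ?_
  rw [← act_act]
  exact pdist_eq_zero_trans (pdist_shift_pointMap φ p n) (hg _)

end InvariantFamily

/-! ### The action of `G` on the model as a topological isomorphism -/

namespace InvariantFamily

open Rigidification

variable {G W : Type u} [Group G] [TopologicalSpace G] {D : InvariantFamily G W}

theorem orbit_dist_translate (g : G) (p q : D.Orbit) :
    dist (⟨g * p.elt, p.seq⟩ : D.Orbit) ⟨g * q.elt, q.seq⟩ = dist p q := by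
  refine tsum_congr fun n => ?_
  simp only [orbitTerm, ← act_act, pdist_act]

theorem dist_translate_single (g h : G) (x : D.Point) :
    dist (⟨g, single 0 x⟩ : D.Orbit) ⟨h, single 0 x⟩ = 1 / 8 * pdist (act g x) (act h x) := by
  rw [orbit_dist_def, tsum_eq_single 0]
  · simp only [orbitTerm, single_self, pdist_self]; norm_num
  · intro n hn
    simp only [orbitTerm, single_of_ne hn, pdist_self]
    rw [pdist_base_act _ g h 1 1, pdist_self]; simp

theorem continuous_orbit_translate [IsTopologicalGroup G] (p : D.Orbit) :
    Continuous fun g : G => (⟨g * p.elt, p.seq⟩ : D.Orbit) := by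
  rw [continuous_iff_continuousAt]
  intro h
  rw [ContinuousAt, tendsto_iff_dist_tendsto_zero]
  have hc : Continuous fun g : G =>
      dist (⟨g * p.elt, p.seq⟩ : D.Orbit) ⟨h * p.elt, p.seq⟩ := by
    refine continuous_tsum (fun n => ?_)
      (summable_geometric_two.mul_left (1 / 4)) fun n g => ?_
    · simp only [orbitTerm, pdist_self, add_zero]
      refine continuous_const.mul ?_
      have : (fun g : G => pdist (act (g * p.elt) (p.seq n)) (act (h * p.elt) (p.seq n))) =
          fun g => D.ρ (p.seq n).1 (h * p.elt * (p.seq n).2) (g * p.elt * (p.seq n).2) := by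
        ext g
        rw [pdist_comm]
        exact pdist_mk _ _ _
      rw [this]
      exact ((D.ρ _).continuous_right _).comp (by fun_prop)
    · rw [Real.norm_eq_abs, abs_of_nonneg (orbitTerm_nonneg _ _ n)]
      exact orbitTerm_le _ _ n
  simpa using hc.tendsto h

variable [LinearOrder W]

/-- The action of `G` on the rigidification of the space of orbits. -/
def translate (g : G) : Rigidification W D.Orbit → Rigidification W D.Orbit
  | pt p => pt ⟨g * p.elt, p.seq⟩
  | lo w => lo w
  | hi w => hi w
  | top => top

theorem isometry_translate (g : G) :
    Isometry (translate g : Rigidification W D.Orbit → Rigidification W D.Orbit) := by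
  refine Isometry.of_dist_eq fun x y => ?_
  rcases x with p | a | a | _ <;> rcases y with q | b | b | _ <;>
    simp only [dist_def, translate, rdist, label_def]
  exact orbit_dist_translate g p q

/-- The action of `G` on the model. -/
noncomputable def translateModel (g : G) : D.Model → D.Model :=
  SeparationQuotient.lift (fun a => SeparationQuotient.mk (translate g a)) fun a b h => by
    rw [SeparationQuotient.mk_eq_mk]
    exact h.map (isometry_translate g).continuous

theorem translateModel_mk (g : G) (a : Rigidification W D.Orbit) :
    translateModel g (SeparationQuotient.mk a : D.Model) = SeparationQuotient.mk (translate g a) :=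
  rfl

theorem translateModel_toModel (g : G) (p : D.Orbit) :
    translateModel g (toModel p) = toModel ⟨g * p.elt, p.seq⟩ := rfl

theorem translateModel_mul (g h : G) (x : D.Model) :
    translateModel (g * h) x = translateModel g (translateModel h x) := by
  obtain ⟨a, rfl⟩ := exists_rep x
  simp only [translateModel_mk]
  rcases a with p | a | a | _ <;> simp [translate, mul_assoc]

theorem translateModel_one (x : D.Model) : translateModel 1 x = x := by
  obtain ⟨a, rfl⟩ := exists_rep x
  simp only [translateModel_mk]
  rcases a with p | a | a | _ <;> simp [translate]

theorem isometry_translateModel (g : G) : Isometry (translateModel g : D.Model → D.Model) := by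
  refine Isometry.of_dist_eq fun x y => ?_
  obtain ⟨a, rfl⟩ := exists_rep x
  obtain ⟨b, rfl⟩ := exists_rep y
  rw [translateModel_mk, translateModel_mk, SeparationQuotient.dist_mk, SeparationQuotient.dist_mk]
  exact (isometry_translate g).dist_eq a b

variable (D) in
/-- The action of `G` on the model as a homomorphism. -/
noncomputable def translateHom : G →* (D.Model ≃ᵢ D.Model) where
  toFun g := IsometryEquiv.mk' (translateModel g) (translateModel g⁻¹)
    (fun x => by rw [← translateModel_mul, mul_inv_cancel, translateModel_one])
    (isometry_translateModel g)
  map_one' := by ext x; exact translateModel_one x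
  map_mul' g h := by ext x; exact translateModel_mul g h x

theorem translateHom_apply (g : G) (x : D.Model) : translateHom D g x = translateModel g x := rfl

/-- One point of the model recovers `ρ i`, with `1 / 8` the weight of the zeroth term. This gives
both faithfulness of the action and continuity of the inverse. -/
theorem dist_translateHom_single (g h : G) (i : D.ι) :
    dist (translateHom D g (toModel ⟨1, single 0 (i, 1)⟩))
      (translateHom D h (toModel ⟨1, single 0 (i, 1)⟩)) = 1 / 8 * D.ρ i 1 (g⁻¹ * h) := by
  rw [translateHom_apply, translateHom_apply, translateModel_toModel, translateModel_toModel,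
    dist_toModel]
  simp only [mul_one]
  rw [dist_translate_single, (D.ρ i).one_inv_mul]
  simp [act, pdist_mk]

theorem translateHom_injective [T2Space G] : Function.Injective (translateHom D) := by
  refine (injective_iff_map_eq_one _).2 fun g hg => ?_
  by_contra hne
  obtain ⟨i, ε, hε, h⟩ := D.exists_ball {g}ᶜ (isOpen_compl_singleton.mem_nhds (Ne.symm hne))
  refine h g ?_ rfl
  have := dist_translateHom_single (D := D) 1 g i
  rw [hg, map_one, dist_self, inv_one, one_mul] at this
  linarith

theorem continuous_toModel : Continuous (toModel : D.Orbit → D.Model) :=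
  (Isometry.of_dist_eq fun p q => dist_toModel p q).continuous

theorem continuous_translateHom [IsTopologicalGroup G] : Continuous (translateHom D) := by
  refine continuous_isometryEquiv_iff.2 fun x => ?_
  obtain ⟨a, rfl⟩ := exists_rep x
  rcases a with p | a | a | _
  · exact continuous_toModel.comp (continuous_orbit_translate p)
  · exact (continuous_const : Continuous fun _ : G => (SeparationQuotient.mk (lo a) : D.Model))
  · exact (continuous_const : Continuous fun _ : G => (SeparationQuotient.mk (hi a) : D.Model))
  · exact (continuous_const : Continuous fun _ : G => (SeparationQuotient.mk (top) : D.Model))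

variable [Nonempty W] [WellFoundedLT W]

theorem translateHom_surjective [IsTopologicalGroup G] (hG : IsGDeltaComplete G) :
    Function.Surjective (translateHom D) := by
  intro φ
  obtain ⟨g, hg⟩ := exists_map_toModel_eq hG φ
  refine ⟨g, IsometryEquiv.ext fun x => ?_⟩
  obtain ⟨a, rfl⟩ := exists_rep x
  rcases a with p | a | a | _
  · exact (hg p).symm
  · exact (map_lo φ a).symm
  · exact (map_hi φ a).symm
  · exact (Rigidification.map_top φ).symm

/-- A `G_δ`-complete group is isomorphic to the isometry group of its model. -/
noncomputable def translateEquiv [IsTopologicalGroup G] [T2Space G] (hG : IsGDeltaComplete G) :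
    G ≃* (D.Model ≃ᵢ D.Model) :=
  MulEquiv.ofBijective (translateHom D) ⟨translateHom_injective, translateHom_surjective hG⟩

theorem continuous_translateEquiv_symm [IsTopologicalGroup G] [T2Space G]
    (hG : IsGDeltaComplete G) : Continuous (translateEquiv (D := D) hG).symm := by
  set e := translateEquiv (D := D) hG
  rw [continuous_iff_continuousAt]
  intro φ
  have h1 : Tendsto (fun ψ => (e.symm φ)⁻¹ * e.symm ψ) (𝓝 φ) (𝓝 1) := by
    intro V hV
    obtain ⟨i, ε, hε, h⟩ := D.exists_ball V hV
    set x : D.Model := toModel ⟨1, single 0 (i, 1)⟩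
    have hc : Continuous fun ψ : D.Model ≃ᵢ D.Model => dist (φ x) (ψ x) :=
      continuous_const.dist (continuous_isometryEquiv_iff.1 continuous_id x)
    have h2 : ∀ᶠ ψ in 𝓝 φ, dist (φ x) (ψ x) < 1 / 8 * ε := by
      refine hc.continuousAt.eventually_lt continuousAt_const ?_
      rw [dist_self]; positivity
    rw [Filter.mem_map]
    filter_upwards [h2] with ψ hψ
    refine h _ ?_
    have h3 := dist_translateHom_single (e.symm φ) (e.symm ψ) i
    have h4 : ∀ ψ, translateHom D (e.symm ψ) = ψ := fun ψ => e.apply_symm_apply ψ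
    rw [h4, h4] at h3
    rw [h3] at hψ
    linarith
  have h2 := h1.const_mul (e.symm φ)
  simpa [ContinuousAt] using h2

/-- A `G_δ`-complete group is isomorphic to the isometry group of its model, as a topological
group. -/
noncomputable def translateContinuousMulEquiv [IsTopologicalGroup G] [T2Space G]
    (hG : IsGDeltaComplete G) : G ≃ₜ* (D.Model ≃ᵢ D.Model) where
  toMulEquiv := translateEquiv hG
  continuous_toFun := continuous_translateHom
  continuous_invFun := continuous_translateEquiv_symm hG

end InvariantFamily

/-! ### Cardinality bounds and the weight of the normed space -/

/-- One representative of each fibre, for codes of accuracy `1 / (n + 1)`, forms a dense set. -/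
theorem exists_dense_of_code {X W : Type u} [PseudoMetricSpace X] (hW : ℵ₀ ≤ #W)
    (h : ∀ ε > 0, ∃ (C : Type u) (c : X → C), #C ≤ #W ∧ ∀ x y, c x = c y → dist x y < ε) :
    ∃ S : Set X, Dense S ∧ #S ≤ #W := by
  rcases isEmpty_or_nonempty X with hX | hX
  · exact ⟨∅, fun x => hX.elim x, by simp⟩
  have h' : ∀ n : ℕ, ∃ c : X → W, ∀ x y, c x = c y → dist x y < 1 / ((n : ℝ) + 1) := fun n => by
    obtain ⟨C, c, ⟨f⟩, hc⟩ := h (1 / ((n : ℝ) + 1)) (by positivity)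
    exact ⟨f ∘ c, fun x y hxy => hc x y (f.injective hxy)⟩
  choose c hc using h'
  refine ⟨Set.range fun p : W × ℕ => Function.invFun (c p.2) p.1, fun x => ?_, ?_⟩
  · rw [Metric.mem_closure_iff]
    intro ε hε
    obtain ⟨n, hn⟩ := exists_nat_one_div_lt hε
    exact ⟨_, ⟨(c n x, n), rfl⟩,
      (hc n _ _ (Function.invFun_eq (f := c n) ⟨x, rfl⟩).symm).trans hn⟩
  · refine mk_range_le.trans ?_
    rw [mk_prod, lift_uzero, mk_nat, lift_aleph0]
    exact mul_le_of_le hW le_rfl hW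

theorem exists_isTopologicalBasis_mk_eq (X : Type u) [TopologicalSpace X] :
    ∃ B : Set (Set X), TopologicalSpace.IsTopologicalBasis B ∧ #B = topWeight X :=
  csInf_mem (s := {c | ∃ B : Set (Set X), TopologicalSpace.IsTopologicalBasis B ∧ #B = c})
    ⟨_, _, TopologicalSpace.isTopologicalBasis_opens, rfl⟩

namespace InvariantFamily

open Rigidification

variable {G W : Type u} [Group G] [TopologicalSpace G]

/-- A base of minimal size supplies a pseudometric for each basic neighbourhood of `1` and, by
choosing a point in each nonempty basic set, a set dense for every pseudometric. -/
theorem exists_of_topWeight_le [IsTopologicalGroup G] (hW : ℵ₀ ≤ #W) (hG : topWeight G ≤ #W) :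
    Nonempty (InvariantFamily G W) := by
  classical
  obtain ⟨B, hB, hBc⟩ := exists_isTopologicalBasis_mk_eq G
  rw [← hBc] at hG
  let ι : Type u := Option {b : B // (1 : G) ∈ b.1}
  choose ρ ε hε hρ using fun b : {b : B // (1 : G) ∈ b.1} =>
    LeftPseudometric.exists_ball_subset b.1.1 ((hB.isOpen b.1.2).mem_nhds b.2)
  let ρ' : ι → LeftPseudometric G := fun o => o.elim 0 ρ
  let pick : B → G := fun b => if h : b.1.Nonempty then h.some else 1
  have hBne : Nonempty B := by
    obtain ⟨b, hb, -⟩ := hB.exists_subset_of_mem_open (Set.mem_univ (1 : G)) isOpen_univ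
    exact ⟨⟨b, hb⟩⟩
  have hι : #ι ≤ #W := by
    rw [mk_option]
    exact add_le_of_le hW ((mk_subtype_le _).trans hG) (one_le_aleph0.trans hW)
  have hA : #(ι × B × ℕ) ≤ #W := by
    rw [mk_prod, lift_id, lift_id, mk_prod, lift_uzero, mk_nat, lift_aleph0]
    exact mul_le_of_le hW hι (mul_le_of_le hW hG hW)
  obtain ⟨f⟩ := hA
  have hsurj : Function.Surjective (Function.invFun f) := Function.invFun_surjective f.injective
  refine ⟨⟨ι, ρ', none, rfl, fun V hV => ?_,
    fun w => ((Function.invFun f w).1, pick (Function.invFun f w).2.1, (Function.invFun f w).2.2),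
    fun i a n δ hδ => ?_⟩⟩
  · obtain ⟨U, hU, hUo, h1⟩ := mem_nhds_iff.1 hV
    obtain ⟨b, hb, h1b, hbU⟩ := hB.exists_subset_of_mem_open h1 hUo
    exact ⟨some ⟨⟨b, hb⟩, h1b⟩, _, hε ⟨⟨b, hb⟩, h1b⟩, fun g hg => hU (hbU (hρ _ g hg))⟩
  · have ho : IsOpen {b | ρ' i a b < δ} :=
      isOpen_lt ((ρ' i).continuous_right a) continuous_const
    obtain ⟨b, hb, hab, hbU⟩ := hB.exists_subset_of_mem_open
      (show a ∈ {b | ρ' i a b < δ} by simpa [(ρ' i).self'] using hδ) ho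
    obtain ⟨w, hw⟩ := hsurj (i, ⟨b, hb⟩, n)
    refine ⟨w, pick ⟨b, hb⟩, by rw [hw], hbU ?_⟩
    have hne : b.Nonempty := ⟨a, hab⟩
    simp only [pick, hne, dif_pos]
    exact hne.some_mem

variable {D : InvariantFamily G W}

/-- The tail of the distance is small, so it suffices to code approximations to the first `N` terms
of the sequence and of its translate. -/
theorem exists_orbit_code (hW : ℵ₀ ≤ #W) {ε : ℝ} (hε : 0 < ε) :
    ∃ (C : Type u) (c : D.Orbit → C), #C ≤ #W ∧ ∀ p q, c p = c q → dist p q < ε := by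
  obtain ⟨N, hN⟩ := exists_pow_lt_of_lt_one hε (by norm_num : (1 / 2 : ℝ) < 1)
  choose w _ hw2 using fun x : D.Point => exists_code_near x 0 (show 0 < ε / 4 by positivity)
  have hnear : ∀ x y : D.Point, w x = w y → pdist x y ≤ ε / 2 := fun x y h => by
    have h1 := hw2 x
    have h2 := hw2 y
    rw [← h, pdist_comm] at h2
    linarith [pdist_triangle x ((D.code (w x)).1, (D.code (w x)).2.1) y]
  refine ⟨Fin N → W × W, fun p n => (w (act p.elt (p.seq n)), w (p.seq n)), ?_, fun p q h => ?_⟩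
  · rw [mk_arrow, mk_fin, lift_natCast, lift_uzero, mk_prod]
    simp only [lift_id, mul_eq_self hW]
    exact power_nat_le hW
  · have hterm : ∀ n, orbitTerm p q n ≤ if n < N then ε * ((1 / 2) ^ n / 8) else
        1 / 4 * (1 / 2) ^ n := fun n => by
      split_ifs with hn
      · have h1 := congrFun h ⟨n, hn⟩
        have h2 := hnear _ _ (congrArg Prod.fst h1)
        have h3 := hnear _ _ (congrArg Prod.snd h1)
        have h4 : (0 : ℝ) ≤ (1 / 2) ^ n := by positivity
        unfold orbitTerm
        rw [pow_add]
        have : pdist (act p.elt (p.seq n)) (act q.elt (q.seq n)) +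
            pdist (p.seq n) (q.seq n) ≤ ε := by
          simp only at h2 h3; linarith
        nlinarith
      · exact orbitTerm_le p q n
    rw [orbit_dist_def, ← (summable_orbitTerm p q).sum_add_tsum_nat_add N]
    have hs1 : ∑ n ∈ Finset.range N, orbitTerm p q n ≤ ε / 4 := by
      have h1 : ∑ n ∈ Finset.range N, orbitTerm p q n ≤
          ∑ n ∈ Finset.range N, ε / 8 * (1 / 2) ^ n := Finset.sum_le_sum fun n hn => by
        have := hterm n
        rw [if_pos (Finset.mem_range.1 hn)] at this
        linarith
      rw [← Finset.mul_sum] at h1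
      have h2 := summable_geometric_two.sum_le_tsum (Finset.range N) (fun n _ => by positivity)
      rw [tsum_geometric_two] at h2
      nlinarith
    have hs2 : ∑' n, orbitTerm p q (n + N) ≤ 1 / 2 * (1 / 2) ^ N := by
      have h1 := ((summable_nat_add_iff N).2 (summable_orbitTerm p q)).tsum_le_tsum
        (g := fun n => 1 / 4 * (1 / 2) ^ N * (1 / 2) ^ n) (fun n => by
          refine (orbitTerm_le p q (n + N)).trans_eq ?_
          rw [pow_add]; ring) (summable_geometric_two.mul_left _)
      rw [tsum_mul_left, tsum_geometric_two] at h1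
      linarith
    linarith

variable [LinearOrder W]

theorem exists_dense_model (hW : ℵ₀ ≤ #W) : ∃ S : Set D.Model, Dense S ∧ #S ≤ #W := by
  refine exists_dense_of_code hW fun ε hε => ?_
  obtain ⟨C, c, hC, hc⟩ := exists_orbit_code (D := D) hW hε
  choose rep hrep using exists_rep (W := W) (P := D.Orbit)
  let code : Rigidification W D.Orbit → C ⊕ (W ⊕ Option W) := fun a => match a with
    | pt p => Sum.inl (c p)
    | lo w => Sum.inr (Sum.inl w)
    | hi w => Sum.inr (Sum.inr (some w))
    | top => Sum.inr (Sum.inr none)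
  refine ⟨C ⊕ (W ⊕ Option W), fun x => code (rep x), ?_, fun x y h => ?_⟩
  · rw [mk_sum, mk_sum, mk_option]
    simp only [lift_id]
    exact add_le_of_le hW hC (add_le_of_le hW le_rfl
      (add_le_of_le hW le_rfl (one_le_aleph0.trans hW)))
  · have key : ∀ a b, code a = code b → rdist a b < ε := fun a b h => by
      rcases a with p | a | a | _ <;> rcases b with q | b | b | _ <;>
        simp only [code, Sum.inl.injEq, Sum.inr.injEq, Option.some.injEq, reduceCtorEq] at h
      · exact hc p q h
      · simpa [rdist, h] using hε
      · simpa [rdist, h] using hε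
      · simpa [rdist] using hε
    rw [← hrep x, ← hrep y, dist_mk]
    exact key _ _ h

theorem dist_model_le_one (m m' : D.Model) : dist m m' ≤ 1 := by
  obtain ⟨a, rfl⟩ := exists_rep m
  obtain ⟨b, rfl⟩ := exists_rep m'
  rw [SeparationQuotient.dist_mk]
  exact dist_le_one a b

theorem topWeight_freeSpace_model (hW : ℵ₀ ≤ #W) : topWeight (FreeSpace D.Model) = #W := by
  have hM := dist_model_le_one (D := D)
  refine le_antisymm ?_ ?_
  · obtain ⟨S, hS, hSc⟩ := exists_dense_model (D := D) hW
    obtain ⟨S', hS', hSc'⟩ := FreeSpace.exists_dense hS hM hW hSc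
    exact topWeight_le_of_dense hS' hW hSc'
  -- The vectors of the points `lo w` are `1 / 2` apart, which makes the weight exactly `#W`.
  · refine le_topWeight_of_separated
      (fun w : W => FreeSpace.of (SeparationQuotient.mk (lo w) : D.Model)) (r := 1 / 2)
      (by norm_num) fun w w' h => ?_
    rw [(FreeSpace.isometry_of hM).dist_eq, dist_mk]
    simp [rdist, h]

end InvariantFamily

theorem corollary5p8 (G : Type u) [Group G] [TopologicalSpace G] [IsTopologicalGroup G]
    [T2Space G] (hG : IsGDeltaComplete G) (β : Cardinal.{u}) (hβ : ℵ₀ ≤ β)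
    (hw : topWeight G ≤ β) :
    ∃ (E : Type u) (_ : NormedAddCommGroup E) (_ : NormedSpace ℝ E) (U : Set E) (e : E),
      ¬ FiniteDimensional ℝ E ∧ topWeight E = β ∧ IsOpen U ∧ ContractibleSpace U ∧ e ≠ 0 ∧
        Nonempty (G ≃ₜ* (U ≃ᵢ U)) ∧ Nonempty (G ≃ₜ* linearIsometriesFixing E e) := by
  -- The labels are indexed by the initial ordinal of `β`: its cardinality fixes the weight and its
  -- well-order gives rigidity.
  have hW : #(β.ord.ToType) = β := mk_ord_toType β
  have hinf : Infinite β.ord.ToType := infinite_iff.2 (by rwa [hW])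
  rw [← hW] at hβ hw
  obtain ⟨D⟩ := InvariantFamily.exists_of_topWeight_le hβ hw
  have hDinf : Infinite D.Model := Infinite.of_injective _ Rigidification.mk_lo_injective
  have hfin := FreeSpace.not_finiteDimensional (M := D.Model)
  have h0 := FreeSpace.unit_ne_zero (M := D.Model)
  let i := (InvariantFamily.translateContinuousMulEquiv (D := D) hG).trans
    (FreeSpace.mapIsoContinuousMulEquiv InvariantFamily.dist_model_le_one)
  exact ⟨FreeSpace D.Model, inferInstance, inferInstance, rayCompl FreeSpace.unit, FreeSpace.unit,
    hfin, (InvariantFamily.topWeight_freeSpace_model hβ).trans hW, isOpen_rayCompl h0,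
    contractibleSpace_rayCompl h0, h0, ⟨i.trans (rayComplContinuousMulEquiv h0 hfin)⟩, ⟨i⟩⟩
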